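/- Let $n\ge 1$, let $\Omega\subset\mathbb R^n$ be a nonempty bounded open set of class $C^1$, let $s\in(0,1)$ and $1<p<\infty$. Let $W^{s,p}(\Omega)$ be the space of all $u\in L^p(\Omega)$ with $\frac{|u(x)-u(y)|}{|x-y|^{n/p+s}}\in L^p(\Omega\times\Omega)$, and write $$[u]_{W^{s,p}(\Omega)}^p=\int_\Omega\int_\Omega\frac{|u(x)-u(y)|^p}{|x-y|^{n+sp}}\,dx\,dy .$$ Put $$\lambda_1(s,p)=\inf\left\{\frac{[v]^p_{W^{s,p}(\Omega)}}{\|v\|^p_{L^p(\Omega)}}\colon v\in W^{s,p}(\Omega),\ v\ne 0,\ \int_\Omega|v|^{p-2}v\,dx=0\right\}.$$ A number $\lambda\in\mathbb R$ is called an eigenvalue (of the Neumann problem for the regional fractional $p$-Laplacian in $\Omega$) if there is $u\in W^{s,p}(\Omega)\setminus\{0\}$ such that $$\int_\Omega\int_\Omega\frac{|u(y)-u(x)|^{p-2}(u(y)-u(x))(\phi(y)-\phi(x))}{|x-y|^{n+sp}}\,dx\,dy=\lambda\int_\Omega|u|^{p-2}u\,\phi\,dx\qquad\text{for all }\phi\in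 C^1(\overline\Omega),$$ where $C^1(\overline\Omega)$ denotes the restrictions to $\overline\Omega$ of $C^1$ functions on $\mathbb R^n$. Then the infimum $\lambda_1(s,p)$ is attained, $\lambda_1(s,p)>0$, and $\lambda_1(s,p)$ is the first non-zero eigenvalue: it is an eigenvalue, and every eigenvalue $\lambda\neq0$ satisfies $\lambda\ge\lambda_1(s,p)$. -/

import Mathlib

open MeasureTheory

noncomputable section

namespace FracNeumann

/-- `Ω` is an open set of class `C¹`: near each boundary point `x₀` there are a direction `e`
(the last axis of a rotated orthonormal coordinate system) and a `C¹` function `γ` of the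
coordinates orthogonal to `e`, such that `Ω` is locally the region strictly above the graph of `γ`.
The point `x - ⟪e, x⟫ e` is the orthogonal projection of `x` to the hyperplane `e^⊥`. -/
structure IsC1OpenSet {n : ℕ} (Ω : Set (EuclideanSpace ℝ (Fin n))) : Prop where
  isOpen : IsOpen Ω
  boundary : ∀ x₀ ∈ frontier Ω, ∃ e : EuclideanSpace ℝ (Fin n), ‖e‖ = 1 ∧
    ∃ γ : EuclideanSpace ℝ (Fin n) → ℝ, ContDiff ℝ 1 γ ∧ ∃ r > 0,
      ∀ x ∈ Metric.ball x₀ r, x ∈ Ω ↔ γ (x - inner ℝ e x • e) < inner ℝ e x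

/-- `u ∈ W^{s,p}(Ω)`. Functions are considered up to equality a.e. in `Ω`. -/
def MemW {n : ℕ} (Ω : Set (EuclideanSpace ℝ (Fin n))) (s p : ℝ)
    (u : EuclideanSpace ℝ (Fin n) → ℝ) : Prop :=
  MemLp u (ENNReal.ofReal p) (volume.restrict Ω) ∧
  MemLp (fun z : EuclideanSpace ℝ (Fin n) × EuclideanSpace ℝ (Fin n) =>
      |u z.1 - u z.2| / ‖z.1 - z.2‖ ^ ((n : ℝ) / p + s))
    (ENNReal.ofReal p) ((volume.restrict Ω).prod (volume.restrict Ω))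

/-- The Gagliardo seminorm `[u]_{W^{s,p}(Ω)}`. -/
def gagliardoSeminorm {n : ℕ} (Ω : Set (EuclideanSpace ℝ (Fin n))) (s p : ℝ)
    (u : EuclideanSpace ℝ (Fin n) → ℝ) : ℝ :=
  (∫ x in Ω, ∫ y in Ω, |u x - u y| ^ p / ‖x - y‖ ^ ((n : ℝ) + s * p)) ^ (1 / p)

/-- The norm `‖u‖_{L^p(Ω)}`. -/
def normLp {n : ℕ} (Ω : Set (EuclideanSpace ℝ (Fin n))) (p : ℝ)
    (u : EuclideanSpace ℝ (Fin n) → ℝ) : ℝ :=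
  (eLpNorm u (ENNReal.ofReal p) (volume.restrict Ω)).toReal

/-- The admissible functions: `v ∈ W^{s,p}(Ω)`, `v ≠ 0` and `∫_Ω |v|^{p-2} v = 0`. -/
def admissible {n : ℕ} (Ω : Set (EuclideanSpace ℝ (Fin n))) (s p : ℝ) :
    Set (EuclideanSpace ℝ (Fin n) → ℝ) :=
  {v | MemW Ω s p v ∧ ¬ v =ᵐ[volume.restrict Ω] 0 ∧ ∫ x in Ω, |v x| ^ (p - 2) * v x = 0}

/-- The quotient `[v]^p_{W^{s,p}(Ω)} / ‖v‖^p_{L^p(Ω)}`. -/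
def quotient {n : ℕ} (Ω : Set (EuclideanSpace ℝ (Fin n))) (s p : ℝ)
    (v : EuclideanSpace ℝ (Fin n) → ℝ) : ℝ :=
  gagliardoSeminorm Ω s p v ^ p / normLp Ω p v ^ p

/-- `λ₁(s,p)`, the infimum of the quotient over the admissible functions. -/
def lambda1 {n : ℕ} (Ω : Set (EuclideanSpace ℝ (Fin n))) (s p : ℝ) : ℝ :=
  sInf (quotient Ω s p '' admissible Ω s p)

/-- The form `ℰ(u, φ)`. -/
def form {n : ℕ} (Ω : Set (EuclideanSpace ℝ (Fin n))) (s p : ℝ)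
    (u φ : EuclideanSpace ℝ (Fin n) → ℝ) : ℝ :=
  ∫ x in Ω, ∫ y in Ω,
    |u y - u x| ^ (p - 2) * (u y - u x) * (φ y - φ x) / ‖x - y‖ ^ ((n : ℝ) + s * p)

/-- `μ` is an eigenvalue of the Neumann problem for the regional fractional `p`-Laplacian:
there is a nonzero `u ∈ W^{s,p}(Ω)` solving the equation weakly, against all test functions in
`C¹(closure Ω)`, that is, restrictions of `C¹` functions on the whole space. -/
def IsEigenvalue {n : ℕ} (Ω : Set (EuclideanSpace ℝ (Fin n))) (s p μ : ℝ) : Prop :=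
  ∃ u : EuclideanSpace ℝ (Fin n) → ℝ, MemW Ω s p u ∧ ¬ u =ᵐ[volume.restrict Ω] 0 ∧
    ∀ φ : EuclideanSpace ℝ (Fin n) → ℝ, ContDiff ℝ 1 φ →
      form Ω s p u φ = μ * ∫ x in Ω, |u x| ^ (p - 2) * u x * φ x

end FracNeumann

end

/-! Write `J t = |t|^(p-2) t` and `D u (x, y) = (u x - u y) / |x - y|^(n/p+s)`. The map `D` is
linear and kills constants, and `[u]^p` is the integral of `|D u|^p` over `Ω × Ω`, so both terms of
the quotient are `p`-th powers of `L^p` norms. The class `C¹` enters only through openness and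
measure density: small balls centred in `Ω` meet `Ω` in volume at least `c r^n`.

Minimizer. Under measure density a bounded set in `W^{s,p}` is totally bounded in `L^p`, since local
averages approximate `u` with error `O(δ^s) [u]` (`totallyBounded_of_measureDensity`). A normalized
minimizing sequence thus converges in `L^p`, and Fatou bounds the seminorm of the limit. The
constraint `∫ J(u) = 0` says that `0` is the best constant approximation of `u` in `L^p`, and in
this form it survives the limit. The minimum is positive because seminorm zero forces a constant,
and the constraint makes that constant zero.

Equation. For a test function `φ` choose `c` such that `u + tφ - c` satisfies the constraint. The
seminorm does not see `c`, and convexity of `|·|^p` bounds the norm of `u + tφ - c` from below by an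
expression affine in `t`, in which `c` drops out by the constraint on `u`. So `t ↦ [u + tφ]^p` has
an affine minorant touching at `t = 0`, whose slope gives the equation (`form_eq_of_minimizer`). No
multiplier rule is needed.

Minimality. For an eigenfunction with nonzero eigenvalue, testing with `1` gives the constraint, and
testing with `u` itself would give quotient equal to the eigenvalue. Only `C¹` tests are allowed, so
`u` is approximated by normalized mollifications, bounded in `W^{s,p}` and convergent a.e.
(`exists_contDiff_approx`); the weak convergence of `tendsto_integral_signedPow_mul` is enough to
pass to the limit. -/

noncomputable section

namespace FracNeumann

open Filter Topology

/-! ### The odd power `t ↦ |t|^(p-2) t` -/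

/-- The odd power function `t ↦ |t|^(p-2) t`. -/
def signedPow (p t : ℝ) : ℝ := |t| ^ (p - 2) * t

lemma abs_signedPow {p : ℝ} (hp : 1 < p) (t : ℝ) : |signedPow p t| = |t| ^ (p - 1) := by
  rcases eq_or_ne t 0 with rfl | ht
  · simp [signedPow, Real.zero_rpow (by linarith : p - 1 ≠ 0)]
  · have h : 0 < |t| := abs_pos.mpr ht
    rw [signedPow, abs_mul, abs_of_nonneg (Real.rpow_nonneg h.le _), ← Real.rpow_add_one h.ne']
    ring_nf

lemma signedPow_mul_self {p : ℝ} (hp : 1 < p) (t : ℝ) : signedPow p t * t = |t| ^ p := by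
  rcases eq_or_ne t 0 with rfl | ht
  · simp [Real.zero_rpow (by linarith : p ≠ 0)]
  · have h : 0 < |t| := abs_pos.mpr ht
    rw [signedPow, mul_assoc, ← abs_mul_abs_self t, ← mul_assoc, ← Real.rpow_add_one h.ne',
      ← Real.rpow_add_one h.ne']
    ring_nf

lemma continuous_signedPow {p : ℝ} (hp : 1 < p) : Continuous (signedPow p) := by
  rw [continuous_iff_continuousAt]
  intro t
  rcases eq_or_ne t 0 with rfl | ht
  · rw [ContinuousAt, show signedPow p 0 = 0 by simp [signedPow], tendsto_zero_iff_abs_tendsto_zero]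
    have h : Continuous fun t : ℝ => |t| ^ (p - 1) :=
      continuous_abs.rpow_const fun _ => Or.inr (by linarith)
    have h0 := h.tendsto 0
    simp only [abs_zero, Real.zero_rpow (by linarith : p - 1 ≠ 0)] at h0
    exact h0.congr fun t => (abs_signedPow hp t).symm
  · exact (continuousAt_id.abs.rpow_const (Or.inl (abs_ne_zero.mpr ht))).mul continuousAt_id

lemma signedPow_mul {p c : ℝ} (hc : 0 < c) (t : ℝ) :
    signedPow p (c * t) = c ^ (p - 1) * signedPow p t := by
  rw [signedPow, signedPow, abs_mul, abs_of_pos hc, Real.mul_rpow hc.le (abs_nonneg _),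
    show p - 1 = p - 2 + 1 by ring, Real.rpow_add_one hc.ne']
  ring

/-- Convexity of `|·|^p` in tangent form. By homogeneity, with `b = r a`, it reduces to `1 + p (r -
1) ≤ |r|^p`, which is Bernoulli's inequality for `|r|` and `r ≤ |r|`. -/
lemma rpow_abs_tangent_le {p : ℝ} (hp : 1 < p) (a b : ℝ) :
    |a| ^ p + p * (signedPow p a * (b - a)) ≤ |b| ^ p := by
  rcases eq_or_ne a 0 with rfl | ha
  · simp only [abs_zero, Real.zero_rpow (by linarith : p ≠ 0), signedPow, mul_zero, zero_mul,
      add_zero]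
    positivity
  · obtain ⟨r, rfl⟩ : ∃ r, b = r * a := ⟨b / a, by field_simp⟩
    have h := one_add_mul_self_le_rpow_one_add (s := |r| - 1) (by linarith [abs_nonneg r]) hp.le
    have h2 : 1 + p * (r - 1) ≤ |r| ^ p := by
      rw [show 1 + (|r| - 1) = |r| by ring] at h
      nlinarith [le_abs_self r]
    rw [show r * a - a = a * (r - 1) by ring, ← mul_assoc (signedPow p a), signedPow_mul_self hp,
      abs_mul, Real.mul_rpow (abs_nonneg _) (abs_nonneg _)]
    nlinarith [Real.rpow_nonneg (abs_nonneg a) p]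

/-- A crude Young inequality: replace the smaller of `|a|`, `|b|` by the larger. It supplies
integrability and dominating functions. -/
lemma abs_signedPow_mul_le {p : ℝ} (hp : 1 < p) (a b : ℝ) :
    |signedPow p a * b| ≤ |a| ^ p + |b| ^ p := by
  have key : ∀ t : ℝ, 0 ≤ t → t ^ (p - 1) * t = t ^ p := fun t ht => by
    rcases ht.eq_or_lt with rfl | ht
    · simp [Real.zero_rpow (by linarith : p ≠ 0)]
    · rw [← Real.rpow_add_one ht.ne']; ring_nf
  rw [abs_mul, abs_signedPow hp]
  have hm : 0 ≤ p - 1 := by linarith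
  rcases le_total |a| |b| with h | h
  · calc |a| ^ (p - 1) * |b| ≤ |b| ^ (p - 1) * |b| := by gcongr
      _ = |b| ^ p := key _ (abs_nonneg _)
      _ ≤ _ := le_add_of_nonneg_left (by positivity)
  · calc |a| ^ (p - 1) * |b| ≤ |a| ^ (p - 1) * |a| := by gcongr
      _ = |a| ^ p := key _ (abs_nonneg _)
      _ ≤ _ := le_add_of_nonneg_right (by positivity)

/-! ### Integral functionals on `L^p` -/

section Lp

variable {X : Type*} [MeasurableSpace X] {ν : Measure X} {p : ℝ}

lemma integrable_abs_rpow (hp : 1 < p) {f : X → ℝ} (hf : MemLp f (ENNReal.ofReal p) ν) :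
    Integrable (fun x => |f x| ^ p) ν := by
  have h := hf.integrable_norm_rpow (by simp; linarith) (by simp)
  simpa [ENNReal.toReal_ofReal (by linarith : 0 ≤ p)] using h

lemma eLpNorm_toReal_rpow (hp : 1 < p) {f : X → ℝ} (hf : AEStronglyMeasurable f ν) :
    (eLpNorm f (ENNReal.ofReal p) ν).toReal ^ p = ∫ x, |f x| ^ p ∂ν := by
  have hp0 : 0 < p := by linarith
  rw [eLpNorm_eq_lintegral_rpow_enorm_toReal (by simp; linarith) (by simp),
    ENNReal.toReal_ofReal hp0.le, ENNReal.toReal_rpow, ← ENNReal.rpow_mul,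
    one_div_mul_cancel hp0.ne', ENNReal.rpow_one, integral_eq_lintegral_of_nonneg_ae]
  · congr 1
    refine lintegral_congr fun x => ?_
    rw [← ENNReal.ofReal_rpow_of_nonneg (abs_nonneg _) hp0.le, Real.enorm_eq_ofReal_abs]
  · exact Eventually.of_forall fun x => by positivity
  · exact ((hf.aemeasurable.norm).pow_const p).aestronglyMeasurable

lemma integrable_signedPow_mul (hp : 1 < p) {f g : X → ℝ} (hf : MemLp f (ENNReal.ofReal p) ν)
    (hg : MemLp g (ENNReal.ofReal p) ν) : Integrable (fun x => signedPow p (f x) * g x) ν := by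
  refine ((integrable_abs_rpow hp hf).add (integrable_abs_rpow hp hg)).mono'
    (((continuous_signedPow hp).comp_aestronglyMeasurable hf.1).mul hg.1) ?_
  exact Eventually.of_forall fun x => abs_signedPow_mul_le hp _ _

lemma continuous_integral_signedPow (hp : 1 < p) {f g h : X → ℝ}
    (hf : MemLp f (ENNReal.ofReal p) ν) (hg : MemLp g (ENNReal.ofReal p) ν)
    (hh : MemLp h (ENNReal.ofReal p) ν) :
    Continuous fun t : ℝ => ∫ x, signedPow p (f x + t * g x) * h x ∂ν := by
  rw [continuous_iff_continuousAt]
  intro t₀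
  have hb : MemLp (fun x => |f x| + (|t₀| + 1) * |g x|) (ENNReal.ofReal p) ν :=
    hf.abs.add (hg.abs.const_mul _)
  refine continuousAt_of_dominated
    (bound := fun x => |(|f x| + (|t₀| + 1) * |g x|)| ^ p + |h x| ^ p) ?_ ?_
    ((integrable_abs_rpow hp hb).add (integrable_abs_rpow hp hh)) ?_
  · exact Eventually.of_forall fun t => (integrable_signedPow_mul hp
      (hf.add (hg.const_mul t)) hh).aestronglyMeasurable
  · filter_upwards [Metric.ball_mem_nhds t₀ one_pos] with t ht
    refine Eventually.of_forall fun x => (abs_signedPow_mul_le hp _ _).trans ?_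
    have ht' : |t| ≤ |t₀| + 1 := by
      rw [Metric.mem_ball, Real.dist_eq] at ht
      linarith [abs_sub_abs_le_abs_sub t t₀]
    refine add_le_add (Real.rpow_le_rpow (abs_nonneg _) ?_ (by linarith)) le_rfl
    calc |f x + t * g x| ≤ |f x| + |t * g x| := abs_add_le _ _
      _ = |f x| + |t| * |g x| := by rw [abs_mul]
      _ ≤ |f x| + (|t₀| + 1) * |g x| := by gcongr
      _ ≤ _ := le_abs_self _
  · refine Eventually.of_forall fun x => ?_
    exact (((continuous_signedPow hp).comp (by fun_prop)).mul continuous_const).continuousAt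

lemma integral_tangent_le (hp : 1 < p) {f g : X → ℝ} (hf : MemLp f (ENNReal.ofReal p) ν)
    (hg : MemLp g (ENNReal.ofReal p) ν) :
    ∫ x, |f x| ^ p ∂ν + p * ∫ x, signedPow p (f x) * (g x - f x) ∂ν ≤ ∫ x, |g x| ^ p ∂ν := by
  have h1 := integrable_abs_rpow hp hf
  have h2 : Integrable (fun x => p * (signedPow p (f x) * (g x - f x))) ν :=
    (integrable_signedPow_mul hp hf (hg.sub hf)).const_mul p
  rw [← integral_const_mul, ← integral_add h1 h2]
  exact integral_mono (h1.add h2) (integrable_abs_rpow hp hg) fun x => rpow_abs_tangent_le hp _ _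

/-- First-order condition for the convex function `t ↦ ∫ |f + t g|^p`: an affine minorant which
touches at `t = 0` has the slope of the derivative. -/
lemma integral_signedPow_mul_eq_of_le (hp : 1 < p) {f g : X → ℝ} {m : ℝ}
    (hf : MemLp f (ENNReal.ofReal p) ν) (hg : MemLp g (ENNReal.ofReal p) ν)
    (h : ∀ t : ℝ, ∫ x, |f x| ^ p ∂ν + p * (t * m) ≤ ∫ x, |f x + t * g x| ^ p ∂ν) :
    ∫ x, signedPow p (f x) * g x ∂ν = m := by
  set F : ℝ → ℝ := fun t => ∫ x, signedPow p (f x + t * g x) * g x ∂ν with hF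
  have hc : Continuous F := continuous_integral_signedPow hp hf hg hg
  -- The tangent inequality at `f + t g`, evaluated at `f`, bounds `∫ |f + t g|^p` above by `∫ |f|^p
  -- + p t F(t)`; comparison with the affine minorant leaves `t m ≤ t F(t)`. Dividing by `t` of
  -- either sign and letting `t → 0` gives both inequalities, without differentiating under the
  -- integral.
  have hle : ∀ t, t * m ≤ t * F t := fun t => by
    have h1 := integral_tangent_le hp (hf.add (hg.const_mul t)) hf
    have h2 : ∫ x, signedPow p ((f + fun x => t * g x) x) * (f x - (f + fun x => t * g x) x) ∂ν
        = - (t * F t) := by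
      rw [hF, ← integral_const_mul, ← integral_neg]
      refine integral_congr_ae (Eventually.of_forall fun x => ?_)
      simp only [Pi.add_apply]
      ring
    rw [h2] at h1
    simp only [Pi.add_apply] at h1
    nlinarith [h t]
  have h0 : F 0 = ∫ x, signedPow p (f x) * g x ∂ν := by simp [hF]
  rw [← h0]
  refine le_antisymm ?_ ?_
  · refine le_of_tendsto (f := F) (x := 𝓝[<] 0) (hc.continuousWithinAt) ?_
    filter_upwards [self_mem_nhdsWithin] with t ht
    exact (mul_le_mul_left_of_neg ht).1 (hle t)
  · refine ge_of_tendsto (f := F) (x := 𝓝[>] 0) (hc.continuousWithinAt) ?_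
    filter_upwards [self_mem_nhdsWithin] with t ht
    exact (mul_le_mul_iff_right₀ ht).1 (hle t)

/-- A sequence which is bounded in `L^p` and converges a.e. converges weakly. -/
lemma tendsto_integral_signedPow_mul (hp : 1 < p) {f F : X → ℝ} {Fs : ℕ → X → ℝ} {C : ℝ}
    (hf : MemLp f (ENNReal.ofReal p) ν) (hF : MemLp F (ENNReal.ofReal p) ν)
    (hFs : ∀ k, MemLp (Fs k) (ENNReal.ofReal p) ν)
    (hC : ∀ k, ∫ x, |Fs k x - F x| ^ p ∂ν ≤ C)
    (hlim : ∀ᵐ x ∂ν, Tendsto (fun k => Fs k x) atTop (𝓝 (F x))) :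
    Tendsto (fun k => ∫ x, signedPow p (f x) * Fs k x ∂ν) atTop
      (𝓝 (∫ x, signedPow p (f x) * F x ∂ν)) := by
  have hp0 : 0 < p := by linarith
  have hsub : ∀ k, MemLp (fun x => Fs k x - F x) (ENNReal.ofReal p) ν := fun k => (hFs k).sub hF
  have hC0 : 0 ≤ C := (integral_nonneg fun x => by positivity).trans (hC 0)
  -- Split at `|b| = K |a|`. Below it the product is at most `K |a|^p`, a fixed dominating function;
  -- above it `|a|^(p-1) ≤ K^(1-p) |b|^(p-1)`, so the product is at most `K^(1-p) |b|^p`, whose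
  -- integral is small uniformly in the sequence once `K` is large.
  have hpt : ∀ K : ℝ, 0 < K → ∀ a b : ℝ,
      |signedPow p a * b| ≤ min |signedPow p a * b| (K * |a| ^ p) + K ^ (1 - p) * |b| ^ p := by
    intro K hK a b
    rcases le_total |b| (K * |a|) with h | h
    · have : |signedPow p a * b| ≤ K * |a| ^ p := by
        rw [← signedPow_mul_self hp a, abs_mul,
          ← abs_of_nonneg (show 0 ≤ signedPow p a * a by rw [signedPow_mul_self hp]; positivity),
          abs_mul]
        nlinarith [mul_le_mul_of_nonneg_left h (abs_nonneg (signedPow p a))]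
      rw [min_eq_left this]
      exact le_add_of_nonneg_right (by positivity)
    · have : |signedPow p a * b| ≤ K ^ (1 - p) * |b| ^ p := by
        rw [← signedPow_mul_self hp b,
          ← abs_of_nonneg (show 0 ≤ signedPow p b * b by rw [signedPow_mul_self hp]; positivity),
          abs_mul, abs_mul, abs_signedPow hp, abs_signedPow hp, ← mul_assoc]
        gcongr
        have h' : (K * |a|) ^ (p - 1) ≤ |b| ^ (p - 1) := by
          apply Real.rpow_le_rpow (by positivity) h; linarith
        rw [Real.mul_rpow hK.le (abs_nonneg _)] at h'
        calc |a| ^ (p - 1) = K ^ (1 - p) * (K ^ (p - 1) * |a| ^ (p - 1)) := by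
              rw [← mul_assoc, ← Real.rpow_add hK]; simp
          _ ≤ _ := by gcongr
      exact this.trans (le_add_of_nonneg_left (by positivity))
  rw [tendsto_iff_norm_sub_tendsto_zero]
  have hbound : ∀ K : ℝ, 0 < K → ∀ k,
      ‖∫ x, signedPow p (f x) * Fs k x ∂ν - ∫ x, signedPow p (f x) * F x ∂ν‖ ≤
      ∫ x, min |signedPow p (f x) * (Fs k x - F x)| (K * |f x| ^ p) ∂ν + K ^ (1 - p) * C := by
    intro K hK k
    have i1 := (integrable_signedPow_mul hp hf (hsub k)).abs.inf
      ((integrable_abs_rpow hp hf).const_mul K)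
    have i2 := (integrable_abs_rpow hp (hsub k)).const_mul (K ^ (1 - p))
    rw [← integral_sub (integrable_signedPow_mul hp hf (hFs k)) (integrable_signedPow_mul hp hf hF)]
    simp_rw [← mul_sub]
    refine (norm_integral_le_integral_norm _).trans ?_
    refine (integral_mono (integrable_signedPow_mul hp hf (hsub k)).norm (i1.add i2)
      fun x => hpt K hK _ _).trans ?_
    rw [integral_add' i1 i2, integral_const_mul]
    exact add_le_add le_rfl (mul_le_mul_of_nonneg_left (hC k) (by positivity))
  have hdct : ∀ K : ℝ, 0 < K → Tendsto (fun k =>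
      ∫ x, min |signedPow p (f x) * (Fs k x - F x)| (K * |f x| ^ p) ∂ν) atTop (𝓝 0) := by
    intro K hK
    rw [← integral_zero X ℝ (μ := ν)]
    refine tendsto_integral_of_dominated_convergence (fun x => K * |f x| ^ p)
      (fun k => ((integrable_signedPow_mul hp hf (hsub k)).abs.inf
        ((integrable_abs_rpow hp hf).const_mul K)).aestronglyMeasurable)
      ((integrable_abs_rpow hp hf).const_mul K) (fun k => Eventually.of_forall fun x => ?_) ?_
    · rw [Real.norm_eq_abs, abs_of_nonneg (le_min (abs_nonneg _) (by positivity))]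
      exact min_le_right _ _
    · filter_upwards [hlim] with x hx
      have h1 : Tendsto (fun k => |signedPow p (f x) * (Fs k x - F x)|) atTop (𝓝 0) := by
        have := (((hx.sub_const (F x)).const_mul (signedPow p (f x)))).abs
        simpa using this
      have h2 := h1.min (tendsto_const_nhds (x := K * |f x| ^ p))
      rwa [min_eq_left (by positivity)] at h2
  have hK : Tendsto (fun K : ℝ => K ^ (1 - p) * C) atTop (𝓝 0) := by
    have := (tendsto_rpow_neg_atTop (by linarith : 0 < p - 1)).mul_const C
    simpa using this
  rw [Metric.tendsto_atTop']
  intro ε hε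
  obtain ⟨K, hKε, hK0⟩ := ((hK.eventually (gt_mem_nhds (half_pos hε))).and
    (eventually_gt_atTop 0)).exists
  obtain ⟨N, hN⟩ := eventually_atTop.1 ((hdct K hK0).eventually (gt_mem_nhds (half_pos hε)))
  refine ⟨N, fun k hk => ?_⟩
  rw [dist_zero_right, norm_norm]
  linarith [hbound K hK0 k, hN k hk.le]

/-- Every `v ∈ L^p` of a finite measure can be shifted by a constant so that the
odd power of the shift has mean zero. -/
lemma exists_integral_signedPow_sub_eq_zero [IsFiniteMeasure ν] (hp : 1 < p) {v : X → ℝ}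
    (hv : MemLp v (ENNReal.ofReal p) ν) : ∃ c : ℝ, ∫ x, signedPow p (v x - c) ∂ν = 0 := by
  rcases eq_zero_or_neZero ν with rfl | hν
  · simp
  have hconst : ∀ c : ℝ, MemLp (fun _ : X => c) (ENNReal.ofReal p) ν := fun c => memLp_const c
  have hcont : Continuous fun c : ℝ => ∫ x, signedPow p (v x + c * -1) * 1 ∂ν :=
    continuous_integral_signedPow hp hv (hconst (-1)) (hconst 1)
  have hpos : 0 < ν.real Set.univ := by simp [Measure.real, ENNReal.toReal_pos_iff, pos_iff_ne_zero, hν.out]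
  -- The intermediate value theorem needs both signs. By homogeneity the integral for `v + a k` is a
  -- positive multiple of that for `a + v / k`, which tends to the integral of `J a` as `k → ∞`;
  -- take `a = 1` and `a = -1`.
  have hsign : ∀ a : ℝ, ∃ k : ℝ, 0 < k ∧
      dist (∫ x, signedPow p (a + k⁻¹ * v x) * 1 ∂ν) (∫ _, signedPow p a ∂ν) < ν.real Set.univ := by
    intro a
    have h1 := ((continuous_integral_signedPow hp (hconst a) hv (hconst 1)).tendsto 0).comp
      (tendsto_inv_atTop_zero (𝕜 := ℝ))
    simp only [zero_mul, add_zero, mul_one] at h1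
    obtain ⟨k, hk, hk0⟩ := ((Metric.tendsto_nhds.1 h1 _ hpos).and (eventually_gt_atTop 0)).exists
    exact ⟨k, hk0, by simpa using hk⟩
  have hscale : ∀ a k : ℝ, 0 < k → ∫ x, signedPow p (v x + (-(a * k)) * -1) * 1 ∂ν =
      k ^ (p - 1) * ∫ x, signedPow p (a + k⁻¹ * v x) * 1 ∂ν := by
    intro a k hk
    rw [← integral_const_mul]
    refine integral_congr_ae (Eventually.of_forall fun x => ?_)
    simp only [mul_one]
    rw [← signedPow_mul hk]
    congr 1
    field_simp
    ring
  obtain ⟨k₁, hk₁, h₁⟩ := hsign 1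
  obtain ⟨k₂, hk₂, h₂⟩ := hsign (-1)
  have e1 : signedPow p 1 = 1 := by simp [signedPow]
  have e2 : signedPow p (-1) = -1 := by simp [signedPow]
  rw [e1, Real.dist_eq, integral_const, abs_lt] at h₁
  rw [e2, Real.dist_eq, integral_const, abs_lt] at h₂
  simp only [smul_eq_mul, mul_one, mul_neg] at h₁ h₂
  have hle : ∫ x, signedPow p (v x + (-((-1) * k₂)) * -1) * 1 ∂ν ≤ 0 := by
    rw [hscale _ _ hk₂]
    simp only [mul_one]
    exact mul_nonpos_of_nonneg_of_nonpos (by positivity) (by linarith)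
  have hge : 0 ≤ ∫ x, signedPow p (v x + (-(1 * k₁)) * -1) * 1 ∂ν := by
    rw [hscale _ _ hk₁]
    simp only [mul_one]
    exact mul_nonneg (by positivity) (by linarith)
  obtain ⟨c, hc⟩ := mem_range_of_exists_le_of_exists_ge hcont ⟨_, hle⟩ ⟨_, hge⟩
  refine ⟨c, ?_⟩
  rw [← hc]
  simp [sub_eq_add_neg]

end Lp

/-! ### Interior ball condition for sets of class `C¹` -/

section Geometry

variable {n : ℕ} {Ω : Set (EuclideanSpace ℝ (Fin n))}

/-- Near a boundary point, move `x` by `r / 2` along the axis `e`. The height above the graph grows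
by `r / 2`, and since `γ` is locally Lipschitz a ball of radius comparable to `r` around the new
point stays above the graph. -/
lemma IsC1OpenSet.exists_ball_subset_near (hΩ : IsC1OpenSet Ω) {x₀ : EuclideanSpace ℝ (Fin n)}
    (hx₀ : x₀ ∈ closure Ω) : ∃ ρ > 0, ∃ κ > 0, ∃ r₀ > 0, ∀ x ∈ Ω ∩ Metric.ball x₀ ρ, ∀ r > 0,
      r ≤ r₀ → ∃ y, Metric.ball y (κ * r) ⊆ Ω ∩ Metric.ball x r := by
  by_cases hx : x₀ ∈ Ω
  · obtain ⟨ε, hε, hball⟩ := Metric.isOpen_iff.1 hΩ.isOpen x₀ hx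
    refine ⟨ε / 2, by positivity, 1, one_pos, ε / 2, by positivity, fun x hx r hr hrr => ⟨x, ?_⟩⟩
    rw [one_mul]
    refine Set.subset_inter ?_ subset_rfl
    refine (Metric.ball_subset_ball' ?_).trans hball
    have := Metric.mem_ball.1 hx.2
    linarith
  · have hfr : x₀ ∈ frontier Ω := by
      rw [hΩ.isOpen.frontier_eq]
      exact ⟨hx₀, hx⟩
    obtain ⟨e, he, γ, hγ, r₁, hr₁, hgraph⟩ := hΩ.boundary x₀ hfr
    set P : EuclideanSpace ℝ (Fin n) → EuclideanSpace ℝ (Fin n) := fun x => x - inner ℝ e x • e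
      with hP
    have hPsub : ∀ x y, P x - P y = P (x - y) := fun x y => by
      simp only [hP, inner_sub_right, sub_smul]
      abel
    have hPnorm : ∀ v, ‖P v‖ ≤ 2 * ‖v‖ := fun v => by
      have h1 : ‖inner ℝ e v • e‖ ≤ ‖v‖ := by
        rw [norm_smul, he, mul_one]
        simpa [he] using norm_inner_le_norm (𝕜 := ℝ) e v
      calc ‖P v‖ ≤ ‖v‖ + ‖inner ℝ e v • e‖ := norm_sub_le _ _
        _ ≤ _ := by linarith
    obtain ⟨K, t, ht, hK⟩ := (hγ.contDiffAt (x := P x₀)).exists_lipschitzOnWith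
    obtain ⟨ε, hε, hεt⟩ := Metric.mem_nhds_iff.1 ht
    -- All points involved lie within `2ρ` of `x₀`, and `P` at most doubles distances by the crude
    -- bound `hPnorm`; so they stay in the graph chart, and their projections stay where `γ` is
    -- Lipschitz.
    set ρ : ℝ := min r₁ ε / 8 with hρ
    have hρ0 : 0 < ρ := by positivity
    have hρ1 : 8 * ρ ≤ r₁ := by rw [hρ]; linarith [min_le_left r₁ ε]
    have hρ2 : 8 * ρ ≤ ε := by rw [hρ]; linarith [min_le_right r₁ ε]
    -- A deviation `v` from the centre costs at most `‖v‖` in height and `2 K ‖v‖` in the graph; `κ`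
    -- makes the total cost less than the gain `r / 2`.
    set κ : ℝ := 1 / (2 * (1 + 2 * K)) with hκ
    have hK0 : (0 : ℝ) ≤ K := K.2
    have hκ0 : 0 < κ := by positivity
    have hκ1 : κ * (1 + 2 * K) = 1 / 2 := by rw [hκ]; field_simp
    refine ⟨ρ, hρ0, κ, hκ0, ρ, hρ0, fun x hx r hr hrr => ⟨x + (r / 2) • e, fun y hy => ?_⟩⟩
    set v := y - (x + (r / 2) • e) with hv
    have hvn : ‖v‖ < κ * r := by rw [hv, ← dist_eq_norm]; exact Metric.mem_ball.1 hy
    have hy' : y - x = (r / 2) • e + v := by rw [hv]; abel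
    have hxx : ‖x - x₀‖ < ρ := by rw [← dist_eq_norm]; exact Metric.mem_ball.1 hx.2
    have hyx : ‖y - x‖ < r := by
      rw [hy']
      calc ‖(r / 2) • e + v‖ ≤ ‖(r / 2) • e‖ + ‖v‖ := norm_add_le _ _
        _ < r / 2 + κ * r := by
          rw [norm_smul, he, Real.norm_of_nonneg (by positivity)]; linarith
        _ ≤ r := by nlinarith
    have hyx₀ : ‖y - x₀‖ < 2 * ρ := by
      have : y - x₀ = (y - x) + (x - x₀) := by abel
      rw [this]
      linarith [norm_add_le (y - x) (x - x₀)]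
    have memt : ∀ z, ‖z - x₀‖ < 2 * ρ → P z ∈ t := fun z hz => hεt <| by
      rw [Metric.mem_ball, dist_eq_norm, hPsub]
      linarith [hPnorm (z - x₀)]
    have hee : inner ℝ e e = (1 : ℝ) := by rw [real_inner_self_eq_norm_sq, he]; norm_num
    have hPyx : P y - P x = P v := by
      rw [hPsub, hy']
      simp only [hP, inner_add_right, inner_smul_right, hee, mul_one, add_smul]
      abel
    have hγ' : γ (P y) ≤ γ (P x) + K * (2 * ‖v‖) := by
      have h1 := hK.dist_le_mul _ (memt y hyx₀) _ (memt x (by linarith))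
      rw [dist_eq_norm, dist_eq_norm, hPyx, Real.norm_eq_abs] at h1
      have h2 := mul_le_mul_of_nonneg_left (hPnorm v) hK0
      linarith [le_abs_self (γ (P y) - γ (P x))]
    have hxΩ : γ (P x) < inner ℝ e x :=
      (hgraph x (by rw [Metric.mem_ball, dist_eq_norm]; linarith)).1 hx.1
    have hin : inner ℝ e y ≥ inner ℝ e x + r / 2 - ‖v‖ := by
      have h1 : inner ℝ e y - inner ℝ e x = r / 2 + inner ℝ e v := by
        rw [← inner_sub_right, hy', inner_add_right, inner_smul_right, hee, mul_one]
      have h2 : |inner ℝ e v| ≤ ‖v‖ := by simpa [he] using abs_real_inner_le_norm e v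
      linarith [neg_abs_le (inner ℝ e v : ℝ)]
    refine ⟨(hgraph y (by rw [Metric.mem_ball, dist_eq_norm]; linarith)).2 ?_, by
      rwa [Metric.mem_ball, dist_eq_norm]⟩
    change γ (P y) < inner ℝ e y
    nlinarith [mul_lt_mul_of_pos_right hvn (by positivity : 0 < 1 + 2 * (K : ℝ))]

/-- The property survives shrinking `κ` and `r₀`, so finitely many local constants can be merged by
compactness of the closure. -/
lemma IsC1OpenSet.exists_ball_subset (hΩ : IsC1OpenSet Ω) (hb : Bornology.IsBounded Ω) :
    ∃ κ > 0, ∃ r₀ > 0, ∀ x ∈ Ω, ∀ r > 0, r ≤ r₀ →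
      ∃ y, Metric.ball y (κ * r) ⊆ Ω ∩ Metric.ball x r := by
  have hcomp : IsCompact (closure Ω) := hb.isCompact_closure
  have := hcomp.induction_on (p := fun S => ∃ κ > 0, ∃ r₀ > 0, ∀ x ∈ Ω ∩ S, ∀ r > 0, r ≤ r₀ →
      ∃ y, Metric.ball y (κ * r) ⊆ Ω ∩ Metric.ball x r)
    ⟨1, one_pos, 1, one_pos, fun x hx => (hx.2).elim⟩
    (fun S T hST ⟨κ, hκ, r₀, hr₀, h⟩ => ⟨κ, hκ, r₀, hr₀, fun x hx => h x ⟨hx.1, hST hx.2⟩⟩)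
    (by
      rintro S T ⟨κ, hκ, r, hr, h⟩ ⟨κ', hκ', r', hr', h'⟩
      refine ⟨min κ κ', lt_min hκ hκ', min r r', lt_min hr hr', fun x hx ρ hρ hρr => ?_⟩
      rcases hx.2 with hS | hT
      · obtain ⟨y, hy⟩ := h x ⟨hx.1, hS⟩ ρ hρ (hρr.trans (min_le_left _ _))
        exact ⟨y, (Metric.ball_subset_ball (by gcongr; exact min_le_left _ _)).trans hy⟩
      · obtain ⟨y, hy⟩ := h' x ⟨hx.1, hT⟩ ρ hρ (hρr.trans (min_le_right _ _))
        exact ⟨y, (Metric.ball_subset_ball (by gcongr; exact min_le_right _ _)).trans hy⟩)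
    (by
      intro x hx
      obtain ⟨ρ, hρ, h⟩ := hΩ.exists_ball_subset_near hx
      exact ⟨Metric.ball x ρ, mem_nhdsWithin_of_mem_nhds (Metric.ball_mem_nhds _ hρ), h⟩)
  obtain ⟨κ, hκ, r₀, hr₀, h⟩ := this
  exact ⟨κ, hκ, r₀, hr₀, fun x hx => h x ⟨hx, subset_closure hx⟩⟩

/-! ### Ball volumes and measure density -/

/-- The volume of the unit ball of `ℝⁿ`. -/
def unitBallVolume (n : ℕ) : ℝ := (volume (Metric.ball (0 : EuclideanSpace ℝ (Fin n)) 1)).toReal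

lemma unitBallVolume_pos (n : ℕ) : 0 < unitBallVolume n :=
  ENNReal.toReal_pos (Metric.measure_ball_pos _ _ one_pos).ne' measure_ball_lt_top.ne

lemma volume_ball_eq (x : EuclideanSpace ℝ (Fin n)) {r : ℝ} (hr : 0 < r) :
    volume (Metric.ball x r) = ENNReal.ofReal (r ^ n * unitBallVolume n) := by
  rw [Measure.addHaar_ball_of_pos _ x hr, finrank_euclideanSpace, Fintype.card_fin,
    ENNReal.ofReal_mul (by positivity), unitBallVolume,
    ENNReal.ofReal_toReal measure_ball_lt_top.ne]

/-- Lower Ahlfors regularity of a measurable set at small scales: balls of radius `r ≤ r₀` centred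
in `Ω` meet `Ω` in a set of volume at least `c r^n`. -/
def MeasureDensity (Ω : Set (EuclideanSpace ℝ (Fin n))) (c r₀ : ℝ) : Prop :=
  ∀ x ∈ Ω, ∀ r > 0, r ≤ r₀ → ENNReal.ofReal (c * r ^ n) ≤ volume (Ω ∩ Metric.ball x r)

lemma IsC1OpenSet.measureDensity (hΩ : IsC1OpenSet Ω) (hb : Bornology.IsBounded Ω) :
    ∃ c > 0, ∃ r₀ > 0, MeasureDensity Ω c r₀ := by
  obtain ⟨κ, hκ, r₀, hr₀, h⟩ := hΩ.exists_ball_subset hb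
  have hv := unitBallVolume_pos n
  refine ⟨κ ^ n * unitBallVolume n, by positivity, r₀, hr₀, fun x hx r hr hrr => ?_⟩
  obtain ⟨y, hy⟩ := h x hx r hr hrr
  refine le_trans (le_of_eq ?_) (measure_mono hy)
  rw [volume_ball_eq y (by positivity)]
  ring_nf

/-! ### The truncated kernel -/

variable {s p : ℝ}

/-- In polar coordinates the integrand is `y^(p-sp-1)` on `(0, 1]`, integrable because `s < 1`, and
`y^(-1-sp)` beyond `1`, integrable because `s > 0`. -/
lemma integrable_truncated_kernel (hn : 1 ≤ n) (hs0 : 0 < s) (hs1 : s < 1) (hp : 1 < p) :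
    Integrable (fun w : EuclideanSpace ℝ (Fin n) =>
      (min 1 ‖w‖ / ‖w‖ ^ ((n : ℝ) / p + s)) ^ p) volume := by
  have hp0 : 0 < p := by linarith
  have : Nonempty (Fin n) := ⟨⟨0, hn⟩⟩
  have hα : ((n : ℝ) / p + s) * p = n + s * p := by field_simp
  rw [integrable_fun_norm_addHaar volume
    (f := fun y : ℝ => (min 1 y / y ^ ((n : ℝ) / p + s)) ^ p), finrank_euclideanSpace,
    Fintype.card_fin, ← Set.Ioc_union_Ioi_eq_Ioi zero_le_one]
  have key : ∀ y : ℝ, 0 < y → y ^ (n - 1) • (min 1 y / y ^ ((n : ℝ) / p + s)) ^ p =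
      min 1 y ^ p * y ^ (-1 - s * p) := by
    intro y hy
    rw [Real.div_rpow (by positivity) (by positivity), ← Real.rpow_mul hy.le, hα, smul_eq_mul,
      ← Real.rpow_natCast, mul_div_assoc', mul_comm, mul_div_assoc, ← Real.rpow_sub hy,
      Nat.cast_sub hn]
    congr 2
    push_cast
    ring
  refine IntegrableOn.union ?_ ?_
  · have h : IntegrableOn (fun y : ℝ => y ^ (p - s * p - 1)) (Set.Ioc 0 1) := by
      rw [← intervalIntegrable_iff_integrableOn_Ioc_of_le zero_le_one]
      exact intervalIntegral.intervalIntegrable_rpow' (by nlinarith)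
    refine h.congr_fun (fun y hy => ?_) measurableSet_Ioc
    rw [key y hy.1, min_eq_right hy.2, ← Real.rpow_add hy.1]
    ring_nf
  · have h : IntegrableOn (fun y : ℝ => y ^ (-1 - s * p)) (Set.Ioi 1) :=
      integrableOn_Ioi_rpow_of_lt (by nlinarith) one_pos
    refine h.congr_fun (fun y hy => ?_) measurableSet_Ioi
    rw [key y (zero_lt_one.trans hy), min_eq_left (le_of_lt hy), Real.one_rpow, one_mul]

/-- Scaling: the kernel at scale `δ` is `δ^(-(n+sp))` times the one at scale `1` evaluated at `(x -
y) / δ`, and the change of variables returns `δ^n`. -/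
lemma exists_lintegral_kernel_le (hn : 1 ≤ n) (hs0 : 0 < s) (hs1 : s < 1) (hp : 1 < p) :
    ∃ C : ℝ, 0 ≤ C ∧ ∀ δ > 0, ∀ x : EuclideanSpace ℝ (Fin n),
      ∫⁻ y, ENNReal.ofReal (min 1 (‖x - y‖ / δ) / ‖x - y‖ ^ ((n : ℝ) / p + s)) ^ p ≤
        ENNReal.ofReal (C * δ ^ (-(s * p))) := by
  have hp0 : 0 < p := by linarith
  have hα : ((n : ℝ) / p + s) * p = n + s * p := by field_simp
  set Φ : EuclideanSpace ℝ (Fin n) → ℝ := fun w => (min 1 ‖w‖ / ‖w‖ ^ ((n : ℝ) / p + s)) ^ p with hΦ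
  have hint := integrable_truncated_kernel (s := s) (p := p) hn hs0 hs1 hp
  have hΦ0 : ∀ w, 0 ≤ Φ w := fun w => by positivity
  refine ⟨∫ w, Φ w, integral_nonneg hΦ0, fun δ hδ x => le_of_eq ?_⟩
  have h1 : ∀ y, ENNReal.ofReal (min 1 (‖x - y‖ / δ) / ‖x - y‖ ^ ((n : ℝ) / p + s)) ^ p =
      ENNReal.ofReal (δ ^ (-(n + s * p)) * Φ (δ⁻¹ • (x - y))) := by
    intro y
    rw [ENNReal.ofReal_rpow_of_nonneg (by positivity) hp0.le]
    congr 1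
    simp only [hΦ, norm_smul, norm_inv, Real.norm_of_nonneg hδ.le]
    rw [Real.mul_rpow (by positivity) (by positivity), ← hα, neg_mul_eq_neg_mul, Real.rpow_mul hδ.le,
      ← Real.mul_rpow (by positivity) (by positivity), Real.inv_rpow hδ.le, Real.rpow_neg hδ.le]
    congr 1
    rw [inv_mul_eq_div]
    have : 0 < δ ^ ((n : ℝ) / p + s) := by positivity
    field_simp
  have hint' : Integrable (fun y => Φ (δ⁻¹ • (x - y))) volume :=
    (hint.comp_smul (inv_ne_zero hδ.ne')).comp_sub_left x
  simp_rw [h1]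
  rw [← ofReal_integral_eq_lintegral_ofReal (hint'.const_mul _)
    (Eventually.of_forall fun y => mul_nonneg (by positivity) (hΦ0 _)), integral_const_mul,
    integral_sub_left_eq_self (fun y => Φ (δ⁻¹ • y)) volume x, Measure.integral_comp_inv_smul,
    finrank_euclideanSpace, Fintype.card_fin, smul_eq_mul, abs_of_nonneg (by positivity),
    ← mul_assoc, ← Real.rpow_natCast, ← Real.rpow_add hδ, mul_comm]
  congr 3
  ring

end Geometry

section DiffQuot

variable {n : ℕ} {Ω : Set (EuclideanSpace ℝ (Fin n))} {s p : ℝ}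

/-! ### Difference quotients -/

/-- The difference quotient `(u x - u y) / |x - y|^(n/p+s)`. -/
def diffQuot (s p : ℝ) (u : EuclideanSpace ℝ (Fin n) → ℝ)
    (z : EuclideanSpace ℝ (Fin n) × EuclideanSpace ℝ (Fin n)) : ℝ :=
  (u z.1 - u z.2) / ‖z.1 - z.2‖ ^ ((n : ℝ) / p + s)

lemma measurable_diffQuot {u : EuclideanSpace ℝ (Fin n) → ℝ} (hu : Measurable u) :
    Measurable (diffQuot s p u) := by
  unfold diffQuot
  fun_prop

lemma aestronglyMeasurable_diffQuot {μ : Measure (EuclideanSpace ℝ (Fin n))} [SFinite μ]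
    {u : EuclideanSpace ℝ (Fin n) → ℝ}
    (hu : AEStronglyMeasurable u μ) : AEStronglyMeasurable (diffQuot s p u) (μ.prod μ) := by
  have h : Measurable fun z : EuclideanSpace ℝ (Fin n) × EuclideanSpace ℝ (Fin n) =>
      ‖z.1 - z.2‖ ^ ((n : ℝ) / p + s) := by fun_prop
  exact ((hu.comp_fst.sub hu.comp_snd).aemeasurable.div h.aemeasurable).aestronglyMeasurable

lemma diffQuot_ae_congr {μ : Measure (EuclideanSpace ℝ (Fin n))} [SFinite μ]
    {u v : EuclideanSpace ℝ (Fin n) → ℝ} (h : u =ᵐ[μ] v) :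
    diffQuot s p u =ᵐ[μ.prod μ] diffQuot s p v := by
  filter_upwards [Measure.quasiMeasurePreserving_fst.ae h,
    Measure.quasiMeasurePreserving_snd.ae h] with z h1 h2
  simp only [diffQuot, h1, h2]

lemma diffQuot_tendsto {μ : Measure (EuclideanSpace ℝ (Fin n))} [SFinite μ]
    {u : EuclideanSpace ℝ (Fin n) → ℝ} {us : ℕ → EuclideanSpace ℝ (Fin n) → ℝ}
    (h : ∀ᵐ x ∂μ, Tendsto (fun k => us k x) atTop (𝓝 (u x))) :
    ∀ᵐ z ∂μ.prod μ, Tendsto (fun k => diffQuot s p (us k) z) atTop (𝓝 (diffQuot s p u z)) := by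
  filter_upwards [Measure.quasiMeasurePreserving_fst.ae h,
    Measure.quasiMeasurePreserving_snd.ae h] with z h1 h2
  exact (h1.sub h2).div_const _

/-- The signed quotient has the same norm as the one with absolute values, and is linear in `u`. -/
lemma memW_iff {u : EuclideanSpace ℝ (Fin n) → ℝ} :
    MemW Ω s p u ↔ MemLp u (ENNReal.ofReal p) (volume.restrict Ω) ∧
      MemLp (diffQuot s p u) (ENNReal.ofReal p)
        ((volume.restrict Ω).prod (volume.restrict Ω)) := by
  refine and_congr_right fun hu => ?_
  rw [← memLp_norm_iff (aestronglyMeasurable_diffQuot hu.1)]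
  simp only [diffQuot, norm_div, Real.norm_eq_abs]
  simp_rw [abs_of_nonneg (Real.rpow_nonneg (norm_nonneg _) _)]

lemma abs_diffQuot_rpow (hp : 1 < p) (u : EuclideanSpace ℝ (Fin n) → ℝ)
    (x y : EuclideanSpace ℝ (Fin n)) :
    |diffQuot s p u (x, y)| ^ p = |u x - u y| ^ p / ‖x - y‖ ^ ((n : ℝ) + s * p) := by
  have hα : ((n : ℝ) / p + s) * p = n + s * p := by field_simp
  simp only [diffQuot]
  rw [abs_div, abs_of_nonneg (Real.rpow_nonneg (norm_nonneg _) _),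
    Real.div_rpow (abs_nonneg _) (by positivity), ← Real.rpow_mul (norm_nonneg _), hα]

/-- The weight `|x-y|^(-(n+sp))` splits into the powers `p - 1` and `1` of `|x-y|^(-(n/p+s))`, and
exchanging `x` and `y` flips two signs. Thus the form is a pairing in `L^p` of the product. -/
lemma signedPow_diffQuot_mul (hp : 1 < p) (u φ : EuclideanSpace ℝ (Fin n) → ℝ)
    (x y : EuclideanSpace ℝ (Fin n)) :
    signedPow p (diffQuot s p u (x, y)) * diffQuot s p φ (x, y) =
      |u y - u x| ^ (p - 2) * (u y - u x) * (φ y - φ x) / ‖x - y‖ ^ ((n : ℝ) + s * p) := by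
  have hα : ((n : ℝ) / p + s) * p = n + s * p := by field_simp
  rcases eq_or_ne x y with rfl | hxy
  · simp [diffQuot]
  · have hk : 0 < ‖x - y‖ := norm_pos_iff.2 (sub_ne_zero.2 hxy)
    simp only [diffQuot, signedPow]
    rw [← hα, Real.rpow_mul hk.le]
    set k := ‖x - y‖ ^ ((n : ℝ) / p + s) with hkk
    have hk' : 0 < k := by positivity
    rw [abs_div, abs_of_pos hk', Real.div_rpow (abs_nonneg _) hk'.le, abs_sub_comm,
      show p = p - 2 + 1 + 1 by ring, Real.rpow_add_one hk'.ne', Real.rpow_add_one hk'.ne',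
      show p - 2 + 1 + 1 - 2 = p - 2 by ring]
    have : 0 < k ^ (p - 2) := by positivity
    field_simp
    ring

lemma gagliardoSeminorm_rpow (hp : 1 < p) {u : EuclideanSpace ℝ (Fin n) → ℝ}
    (hu : MemW Ω s p u) :
    gagliardoSeminorm Ω s p u ^ p =
      ∫ z, |diffQuot s p u z| ^ p ∂((volume.restrict Ω).prod (volume.restrict Ω)) := by
  rw [integral_prod _ (integrable_abs_rpow hp (memW_iff.1 hu).2), gagliardoSeminorm,
    ← Real.rpow_mul (integral_nonneg fun x => integral_nonneg fun y => by positivity),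
    one_div_mul_cancel (by linarith), Real.rpow_one]
  simp_rw [abs_diffQuot_rpow hp]

lemma form_eq_integral (hp : 1 < p) {u φ : EuclideanSpace ℝ (Fin n) → ℝ}
    (hu : MemW Ω s p u) (hφ : MemW Ω s p φ) :
    form Ω s p u φ = ∫ z, signedPow p (diffQuot s p u z) * diffQuot s p φ z
      ∂((volume.restrict Ω).prod (volume.restrict Ω)) := by
  rw [integral_prod _ (integrable_signedPow_mul hp (memW_iff.1 hu).2 (memW_iff.1 hφ).2), form]
  simp_rw [signedPow_diffQuot_mul hp]

lemma quotient_eq (hp : 1 < p) {u : EuclideanSpace ℝ (Fin n) → ℝ} (hu : MemW Ω s p u) :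
    quotient Ω s p u =
      (∫ z, |diffQuot s p u z| ^ p ∂((volume.restrict Ω).prod (volume.restrict Ω))) /
        ∫ x in Ω, |u x| ^ p := by
  rw [quotient, gagliardoSeminorm_rpow hp hu, normLp, eLpNorm_toReal_rpow hp hu.1.1]

lemma diffQuot_add_mul (u v : EuclideanSpace ℝ (Fin n) → ℝ) (t : ℝ)
    (z : EuclideanSpace ℝ (Fin n) × EuclideanSpace ℝ (Fin n)) :
    diffQuot s p (fun x => u x + t * v x) z = diffQuot s p u z + t * diffQuot s p v z := by
  simp only [diffQuot]
  ring

lemma diffQuot_sub_const (u : EuclideanSpace ℝ (Fin n) → ℝ) (c : ℝ) :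
    diffQuot s p (fun x => u x - c) = diffQuot s p u := by
  ext z
  simp [diffQuot]

lemma MemW.add_mul {u v : EuclideanSpace ℝ (Fin n) → ℝ} (hu : MemW Ω s p u) (hv : MemW Ω s p v)
    (t : ℝ) : MemW Ω s p fun x => u x + t * v x := by
  rw [memW_iff] at *
  refine ⟨hu.1.add (hv.1.const_mul t), ?_⟩
  rw [show diffQuot s p (fun x => u x + t * v x) = fun z => diffQuot s p u z + t * diffQuot s p v z
    from funext (diffQuot_add_mul u v t)]
  exact hu.2.add (hv.2.const_mul t)

lemma MemW.sub_const [IsFiniteMeasure (volume.restrict Ω)] {u : EuclideanSpace ℝ (Fin n) → ℝ}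
    (hu : MemW Ω s p u) (c : ℝ) : MemW Ω s p fun x => u x - c := by
  rw [memW_iff] at *
  rw [diffQuot_sub_const]
  exact ⟨hu.1.sub (memLp_const c), hu.2⟩

/-! ### Local oscillation -/

/-- The unnormalized `L¹` oscillation of `u` around `u x` at scale `δ`. -/
def osc (Ω : Set (EuclideanSpace ℝ (Fin n))) (δ : ℝ) (u : EuclideanSpace ℝ (Fin n) → ℝ)
    (x : EuclideanSpace ℝ (Fin n)) : ENNReal :=
  ∫⁻ z in Ω, (Metric.ball x (3 * δ)).indicator (fun z => ‖u z - u x‖ₑ) z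

lemma osc_eq (δ : ℝ) (u : EuclideanSpace ℝ (Fin n) → ℝ) (x : EuclideanSpace ℝ (Fin n)) :
    osc Ω δ u x = ∫⁻ z in Ω ∩ Metric.ball x (3 * δ), ‖u z - u x‖ₑ := by
  rw [osc, lintegral_indicator Metric.isOpen_ball.measurableSet,
    Measure.restrict_restrict Metric.isOpen_ball.measurableSet, Set.inter_comm]

lemma measurable_osc (δ : ℝ) {u : EuclideanSpace ℝ (Fin n) → ℝ} (hu : Measurable u) :
    Measurable (osc Ω δ u) := by
  refine Measurable.lintegral_prod_right'
    (f := fun z : EuclideanSpace ℝ (Fin n) × EuclideanSpace ℝ (Fin n) =>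
      (Metric.ball z.1 (3 * δ)).indicator (fun y => ‖u y - u z.1‖ₑ) z.2) ?_
  have : (fun z : EuclideanSpace ℝ (Fin n) × EuclideanSpace ℝ (Fin n) =>
      (Metric.ball z.1 (3 * δ)).indicator (fun y => ‖u y - u z.1‖ₑ) z.2) =
      {z | dist z.2 z.1 < 3 * δ}.indicator (fun z => ‖u z.2 - u z.1‖ₑ) := by
    ext z
    simp [Set.indicator, Metric.mem_ball]
  rw [this]
  exact Measurable.indicator (by fun_prop) (measurableSet_lt (by fun_prop) (by fun_prop))

lemma lintegral_rpow_le {X : Type*} [MeasurableSpace X] {ν : Measure X} (hp : 1 < p) {f : X → ℝ}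
    (hf : AEStronglyMeasurable f ν) :
    (∫⁻ x, ‖f x‖ₑ ∂ν) ^ p ≤ ν Set.univ ^ (p - 1) * ∫⁻ x, ‖f x‖ₑ ^ p ∂ν := by
  have hp0 : 0 < p := by linarith
  have h := eLpNorm_le_eLpNorm_mul_rpow_measure_univ (p := 1) (q := ENNReal.ofReal p)
    (by simpa using hp.le) hf
  rw [eLpNorm_one_eq_lintegral_enorm, eLpNorm_eq_lintegral_rpow_enorm_toReal (by simp; linarith)
    (by simp), ENNReal.toReal_ofReal hp0.le] at h
  refine (ENNReal.rpow_le_rpow h hp0.le).trans (le_of_eq ?_)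
  rw [ENNReal.mul_rpow_of_nonneg _ _ hp0.le, ← ENNReal.rpow_mul, ← ENNReal.rpow_mul,
    one_div_mul_cancel hp0.ne', ENNReal.rpow_one, mul_comm]
  congr 2
  rw [ENNReal.toReal_one]
  field_simp

lemma enorm_rpow_le_diffQuot (hp : 1 < p) (hs0 : 0 < s) {δ : ℝ}
    (u : EuclideanSpace ℝ (Fin n) → ℝ) {x y : EuclideanSpace ℝ (Fin n)} (h : dist y x < δ) :
    ‖u y - u x‖ₑ ^ p ≤ ENNReal.ofReal (δ ^ ((n : ℝ) + s * p)) * ‖diffQuot s p u (x, y)‖ₑ ^ p := by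
  have hp0 : 0 < p := by linarith
  have hδ : 0 < δ := dist_nonneg.trans_lt h
  rw [Real.enorm_eq_ofReal_abs, Real.enorm_eq_ofReal_abs,
    ENNReal.ofReal_rpow_of_nonneg (abs_nonneg _) hp0.le,
    ENNReal.ofReal_rpow_of_nonneg (abs_nonneg _) hp0.le, ← ENNReal.ofReal_mul (by positivity)]
  refine ENNReal.ofReal_le_ofReal ?_
  rw [abs_diffQuot_rpow hp, abs_sub_comm]
  rcases eq_or_ne x y with rfl | hxy
  · simp [Real.zero_rpow hp0.ne']
  · have hk : 0 < ‖x - y‖ := norm_pos_iff.2 (sub_ne_zero.2 hxy)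
    rw [mul_div_assoc', le_div_iff₀ (by positivity), mul_comm]
    gcongr
    rw [← dist_eq_norm, dist_comm]
    exact h.le

/-- Hölder on the ball of radius `3δ` gives `δ^(n(p-1))`, inserting the kernel gives `δ^(n+sp)`, and
the normalization divides by `δ^(np)`; what remains is `δ^(sp)`. -/
lemma lintegral_osc_rpow_le (hp : 1 < p) (hs0 : 0 < s) {c : ℝ} (hc : 0 < c) :
    ∃ C : ℝ, 0 ≤ C ∧ ∀ δ > 0, ∀ u : EuclideanSpace ℝ (Fin n) → ℝ, Measurable u →
      ∫⁻ x in Ω, (osc Ω δ u x / ENNReal.ofReal (c * δ ^ n)) ^ p ≤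
        ENNReal.ofReal (C * δ ^ (s * p)) *
          ∫⁻ z, ‖diffQuot s p u z‖ₑ ^ p ∂((volume.restrict Ω).prod (volume.restrict Ω)) := by
  have hp0 : 0 < p := by linarith
  have hω := unitBallVolume_pos n
  refine ⟨(3 ^ n * unitBallVolume n) ^ (p - 1) * 3 ^ ((n : ℝ) + s * p) / c ^ p, by positivity,
    fun δ hδ u hu => ?_⟩
  set V : ℝ := (3 * δ) ^ n * unitBallVolume n with hV
  have hV0 : 0 < V := by positivity
  have h1 : ∀ x, osc Ω δ u x ^ p ≤ ENNReal.ofReal (V ^ (p - 1) * (3 * δ) ^ ((n : ℝ) + s * p)) *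
      ∫⁻ z in Ω, ‖diffQuot s p u (x, z)‖ₑ ^ p := by
    intro x
    rw [osc_eq]
    refine (lintegral_rpow_le hp (hu.sub_const (u x)).aestronglyMeasurable).trans ?_
    rw [ENNReal.ofReal_mul (by positivity), mul_assoc]
    refine mul_le_mul' ?_ ?_
    · rw [← ENNReal.ofReal_rpow_of_pos hV0, Measure.restrict_apply_univ, hV,
        ← volume_ball_eq x (by positivity)]
      exact ENNReal.rpow_le_rpow (measure_mono Set.inter_subset_right) (by linarith)
    · rw [← lintegral_const_mul' _ _ (by finiteness)]
      calc ∫⁻ z in Ω ∩ Metric.ball x (3 * δ), ‖u z - u x‖ₑ ^ p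
          ≤ ∫⁻ z in Ω ∩ Metric.ball x (3 * δ), ENNReal.ofReal ((3 * δ) ^ ((n : ℝ) + s * p)) *
              ‖diffQuot s p u (x, z)‖ₑ ^ p := by
            rw [Set.inter_comm, ← Measure.restrict_restrict Metric.isOpen_ball.measurableSet]
            refine lintegral_mono_ae ((ae_restrict_mem Metric.isOpen_ball.measurableSet).mono
              fun z hz => enorm_rpow_le_diffQuot hp hs0 u hz)
        _ ≤ _ := lintegral_mono_set Set.inter_subset_left
  have hm : 0 < c * δ ^ n := by positivity
  calc ∫⁻ x in Ω, (osc Ω δ u x / ENNReal.ofReal (c * δ ^ n)) ^ p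
      ≤ ∫⁻ x in Ω, ENNReal.ofReal (V ^ (p - 1) * (3 * δ) ^ ((n : ℝ) + s * p) / (c * δ ^ n) ^ p) *
          ∫⁻ z in Ω, ‖diffQuot s p u (x, z)‖ₑ ^ p := by
        refine lintegral_mono fun x => ?_
        rw [ENNReal.div_rpow_of_nonneg _ _ hp0.le, ENNReal.ofReal_rpow_of_pos hm,
          ENNReal.ofReal_div_of_pos (by positivity), div_eq_mul_inv, div_eq_mul_inv, mul_right_comm]
        gcongr
        exact h1 x
    _ = ENNReal.ofReal (V ^ (p - 1) * (3 * δ) ^ ((n : ℝ) + s * p) / (c * δ ^ n) ^ p) *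
          ∫⁻ z, ‖diffQuot s p u z‖ₑ ^ p ∂((volume.restrict Ω).prod (volume.restrict Ω)) := by
        rw [lintegral_const_mul' _ _ (by finiteness), lintegral_prod]
        exact ((measurable_diffQuot hu).enorm.pow_const p).aemeasurable
    _ = _ := by
        congr 2
        rw [hV, mul_pow, show (3 : ℝ) ^ n * δ ^ n * unitBallVolume n =
          (3 ^ n * unitBallVolume n) * δ ^ n by ring, Real.mul_rpow (by positivity) (by positivity),
          Real.mul_rpow (by positivity) hδ.le, Real.mul_rpow hc.le (by positivity),
          Real.rpow_add hδ, Real.rpow_natCast,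
          show (δ ^ n) ^ p = (δ ^ n) ^ (p - 1) * δ ^ n by
            rw [← Real.rpow_add_one (by positivity)]; ring_nf]
        field_simp

/-- The normalized oscillation is small in `L^p` at small scales. -/
lemma eLpNorm_osc_le (hp : 1 < p) (hs0 : 0 < s) {c : ℝ} (hc : 0 < c) :
    ∃ C : ℝ, 0 ≤ C ∧ ∀ δ > 0, ∀ u : EuclideanSpace ℝ (Fin n) → ℝ, Measurable u →
      eLpNorm (fun x => osc Ω δ u x / ENNReal.ofReal (c * δ ^ n)) (ENNReal.ofReal p)
        (volume.restrict Ω) ≤ ENNReal.ofReal (C * δ ^ s) *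
        eLpNorm (diffQuot s p u) (ENNReal.ofReal p)
          ((volume.restrict Ω).prod (volume.restrict Ω)) := by
  have hp0 : 0 < p := by linarith
  obtain ⟨C, hC, h⟩ := lintegral_osc_rpow_le (Ω := Ω) (n := n) hp hs0 hc
  refine ⟨C ^ (1 / p), by positivity, fun δ hδ u hu => ?_⟩
  rw [eLpNorm_eq_lintegral_rpow_enorm_toReal (by simp; linarith) (by simp),
    eLpNorm_eq_lintegral_rpow_enorm_toReal (by simp; linarith) (by simp),
    ENNReal.toReal_ofReal hp0.le]
  refine (ENNReal.rpow_le_rpow (h δ hδ u hu) (by positivity)).trans (le_of_eq ?_)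
  rw [ENNReal.mul_rpow_of_nonneg _ _ (by positivity),
    ENNReal.ofReal_rpow_of_nonneg (by positivity) (by positivity),
    Real.mul_rpow hC (by positivity), ← Real.rpow_mul hδ.le]
  congr 4
  field_simp

end DiffQuot

section Compactness

variable {n : ℕ} {Ω : Set (EuclideanSpace ℝ (Fin n))} {s p : ℝ}

/-! ### Compactness in `L^p` -/

/-- The average is centred at a nearby point `y`, so that finitely many centres serve all `x`; its
ball lies in the ball around `x` that defines the oscillation, and density bounds its volume below.
-/
lemma enorm_sub_average_le {c r₀ δ : ℝ} (hden : MeasureDensity Ω c r₀) (hc : 0 < c) (hδ : 0 < δ)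
    (hδr : δ ≤ r₀) {u : EuclideanSpace ℝ (Fin n) → ℝ} (hu : Integrable u (volume.restrict Ω))
    {x y : EuclideanSpace ℝ (Fin n)} (hy : y ∈ Ω) (hxy : dist x y < δ) :
    ‖u x - ⨍ z in Ω ∩ Metric.ball y δ, u z‖ₑ ≤ osc Ω δ u x / ENNReal.ofReal (c * δ ^ n) := by
  set A := Ω ∩ Metric.ball y δ with hA
  have hpos : ENNReal.ofReal (c * δ ^ n) ≤ volume A := hden y hy δ hδ hδr
  have hA0 : volume A ≠ 0 := fun h => by
    rw [h, nonpos_iff_eq_zero, ENNReal.ofReal_eq_zero] at hpos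
    exact absurd hpos (not_le.2 (by positivity))
  have hAt : volume A ≠ ⊤ :=
    ((measure_mono Set.inter_subset_right).trans_lt measure_ball_lt_top).ne
  have hAu : IntegrableOn u A := IntegrableOn.mono_set hu Set.inter_subset_left
  have : NeZero (volume.restrict A) := ⟨by rwa [Ne, Measure.restrict_eq_zero]⟩
  have : IsFiniteMeasure (volume.restrict A) := ⟨by simpa using hAt.lt_top⟩
  have h1 : u x - ⨍ z in A, u z = ⨍ z in A, (u x - u z) := by
    rw [average_eq, average_eq, integral_sub (integrable_const _) hAu, smul_sub, integral_const,
      smul_smul, inv_mul_cancel₀, one_smul]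
    simp [Measure.real, ENNReal.toReal_eq_zero_iff, hA0, hAt]
  rw [h1, average]
  refine (enorm_integral_le_lintegral_enorm _).trans ?_
  rw [lintegral_smul_measure, smul_eq_mul, Measure.restrict_apply_univ, mul_comm,
    ← div_eq_mul_inv, osc_eq]
  refine ENNReal.div_le_div ?_ hpos
  have hsub : A ⊆ Ω ∩ Metric.ball x (3 * δ) := by
    refine Set.inter_subset_inter_right _ (Metric.ball_subset_ball' ?_)
    rw [dist_comm]
    linarith
  refine le_trans (le_of_eq ?_) (lintegral_mono_set hsub)
  refine lintegral_congr fun z => ?_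
  rw [← enorm_neg, neg_sub]

lemma enorm_average_le {c r₀ δ : ℝ} (hden : MeasureDensity Ω c r₀) (hδ : 0 < δ)
    (hδr : δ ≤ r₀) (u : EuclideanSpace ℝ (Fin n) → ℝ) {y : EuclideanSpace ℝ (Fin n)} (hy : y ∈ Ω) :
    ‖⨍ z in Ω ∩ Metric.ball y δ, u z‖ₑ ≤
      (∫⁻ z in Ω, ‖u z‖ₑ) / ENNReal.ofReal (c * δ ^ n) := by
  rw [average]
  refine (enorm_integral_le_lintegral_enorm _).trans ?_
  rw [lintegral_smul_measure, smul_eq_mul, Measure.restrict_apply_univ, mul_comm,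
    ← div_eq_mul_inv]
  exact ENNReal.div_le_div (lintegral_mono_set Set.inter_subset_left) (hden y hy δ hδ hδr)

/-- A function is encoded, up to `ε`, by its averages over `δ`-balls at the points of a finite
`δ`-net, rounded to multiples of `η`. Two functions with the same code differ by their two
oscillations, each below `ε / 3` in norm, plus the rounding error `η`. -/
lemma totallyBounded_of_measureDensity (hs0 : 0 < s) (hp : 1 < p)
    [Fact (1 ≤ ENNReal.ofReal p)] [IsFiniteMeasure (volume.restrict Ω)]
    (hΩ : MeasurableSet Ω) (hb : Bornology.IsBounded Ω)
    {c r₀ : ℝ} (hc : 0 < c) (hr₀ : 0 < r₀) (hden : MeasureDensity Ω c r₀) (R R' : ℝ) :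
    TotallyBounded {f : Lp ℝ (ENNReal.ofReal p) (volume.restrict Ω) | ‖f‖ ≤ R ∧
      eLpNorm (diffQuot s p f) (ENNReal.ofReal p)
        ((volume.restrict Ω).prod (volume.restrict Ω)) ≤ ENNReal.ofReal R'} := by
  have hp0 : 0 < p := by linarith
  have hP1 : (1 : ENNReal) ≤ ENNReal.ofReal p := Fact.out
  obtain ⟨C, hC, hosc⟩ := eLpNorm_osc_le (Ω := Ω) (n := n) hp hs0 hc
  refine Metric.totallyBounded_of_finite_discretization fun ε hε => ?_
  obtain ⟨δ, hδε, hδ0, hδr⟩ : ∃ δ : ℝ, C * δ ^ s * R' < ε / 3 ∧ 0 < δ ∧ δ ≤ r₀ := by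
    have h1 : Tendsto (fun δ : ℝ => C * δ ^ s * R') (𝓝[>] 0) (𝓝 0) := by
      have : ContinuousAt (fun δ : ℝ => C * δ ^ s * R') 0 :=
        ((continuousAt_id.rpow_const (Or.inr hs0.le)).const_mul C).mul_const R'
      have h := this.continuousWithinAt (s := Set.Ioi 0)
      simpa [ContinuousWithinAt, Real.zero_rpow hs0.ne'] using h
    have h2 : ∀ᶠ δ : ℝ in 𝓝[>] 0, δ ∈ Set.Ioc 0 r₀ := Ioc_mem_nhdsGT hr₀
    obtain ⟨δ, h, h'⟩ := ((h1.eventually (gt_mem_nhds (by positivity : 0 < ε / 3))).and h2).exists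
    exact ⟨δ, h, h'.1, h'.2⟩
  obtain ⟨η, hη0, hη⟩ : ∃ η : ℝ, 0 < η ∧
      η * ((volume.restrict Ω) Set.univ ^ (1 / p)).toReal < ε / 3 := by
    obtain ⟨η, h1, h2⟩ := exists_pos_mul_lt (show 0 < ε / 3 by positivity)
      ((volume.restrict Ω) Set.univ ^ (1 / p)).toReal
    exact ⟨η, h1, by rwa [mul_comm]⟩
  obtain ⟨t, htΩ, htfin, htcov⟩ := Metric.finite_approx_of_totallyBounded
    (hb.isCompact_closure.totallyBounded.subset subset_closure) δ hδ0
  have : Fintype t := htfin.fintype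
  set a : (EuclideanSpace ℝ (Fin n) → ℝ) → EuclideanSpace ℝ (Fin n) → ℝ :=
    fun u y => ⨍ z in Ω ∩ Metric.ball y δ, u z with ha
  -- At fixed `δ` the averages are bounded through the `L¹` norm, hence through `R`, so only
  -- finitely many codes occur.
  obtain ⟨N, hN⟩ : ∃ N : ℕ, ∀ f : Lp ℝ (ENNReal.ofReal p) (volume.restrict Ω), ‖f‖ ≤ R →
      ∀ y ∈ t, |a f y / η| ≤ N := by
    set B : ENNReal := ENNReal.ofReal R *
      (volume.restrict Ω) Set.univ ^ (1 / (1 : ENNReal).toReal - 1 / (ENNReal.ofReal p).toReal) /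
        ENNReal.ofReal (c * δ ^ n) with hB
    have hBtop : B ≠ ⊤ := by
      refine ENNReal.div_ne_top (ENNReal.mul_ne_top (by simp) ?_) ?_
      · refine ENNReal.rpow_ne_top_of_nonneg ?_ (measure_ne_top _ _)
        rw [ENNReal.toReal_one, ENNReal.toReal_ofReal hp0.le]
        have : 1 / p ≤ 1 := by rw [div_le_one hp0]; exact hp.le
        linarith
      · simp only [ne_eq, ENNReal.ofReal_eq_zero, not_le]
        positivity
    obtain ⟨N, hN⟩ := exists_nat_ge (B.toReal / η)
    refine ⟨N, fun f hf y hy => le_trans ?_ hN⟩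
    rw [abs_div, abs_of_pos hη0]
    gcongr
    have h1 : ‖a f y‖ₑ ≤ B := by
      refine (enorm_average_le hden hδ0 hδr f (htΩ hy)).trans ?_
      rw [hB]
      gcongr
      rw [← eLpNorm_one_eq_lintegral_enorm]
      refine (eLpNorm_le_eLpNorm_mul_rpow_measure_univ hP1 (Lp.aestronglyMeasurable f)).trans ?_
      gcongr
      rw [← Lp.enorm_def, ← ofReal_norm]
      exact ENNReal.ofReal_le_ofReal hf
    rw [← Real.norm_eq_abs, ← toReal_enorm]
    exact ENNReal.toReal_mono hBtop h1
  refine ⟨t → Finset.Icc (-(N : ℤ)) N, inferInstance, fun f y => ⟨⌊a f.1 y / η⌋, ?_⟩, ?_⟩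
  · have := abs_le.1 (hN f.1 f.2.1 y y.2)
    rw [Finset.mem_Icc]
    refine ⟨Int.le_floor.2 (by push_cast; exact this.1), ?_⟩
    exact_mod_cast (Int.floor_le _).trans this.2
  · rintro ⟨f, hf⟩ ⟨g, hg⟩ hfg
    have hclose : ∀ y ∈ t, |a f y - a g y| ≤ η := by
      intro y hy
      have h1 : ⌊a f y / η⌋ = ⌊a g y / η⌋ := by
        have := congrFun hfg ⟨y, hy⟩
        simpa using congrArg Subtype.val this
      have h2 := Int.abs_sub_lt_one_of_floor_eq_floor h1
      rw [← sub_div, abs_div, abs_of_pos hη0, div_lt_one hη0] at h2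
      exact h2.le
    have hm : ∀ h : Lp ℝ (ENNReal.ofReal p) (volume.restrict Ω), Measurable h := fun h =>
      (Lp.stronglyMeasurable h).measurable
    have hi : ∀ h : Lp ℝ (ENNReal.ofReal p) (volume.restrict Ω),
      Integrable h (volume.restrict Ω) := fun h => (Lp.memLp h).integrable hP1
    obtain ⟨G, hG⟩ : ∃ G : Lp ℝ (ENNReal.ofReal p) (volume.restrict Ω) →
        EuclideanSpace ℝ (Fin n) → ENNReal,
        ∀ h, G h = fun x => osc Ω δ h x / ENNReal.ofReal (c * δ ^ n) := ⟨_, fun _ => rfl⟩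
    have hGm : ∀ h, AEStronglyMeasurable (G h) (volume.restrict Ω) := fun h => by
      rw [hG]
      exact ((measurable_osc δ (hm h)).div_const _).aestronglyMeasurable
    have hpt : ∀ᵐ x ∂(volume.restrict Ω), ‖(f - g : EuclideanSpace ℝ (Fin n) → ℝ) x‖ₑ ≤
        ‖(G f + G g + fun _ => ENNReal.ofReal η : EuclideanSpace ℝ (Fin n) → ENNReal) x‖ₑ := by
      filter_upwards [ae_restrict_mem hΩ] with x hx
      obtain ⟨y, hy, hxy⟩ := Set.mem_iUnion₂.1 (htcov hx)
      have e : (f - g : EuclideanSpace ℝ (Fin n) → ℝ) x =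
          (f x - a f y) + -(g x - a g y) + (a f y - a g y) := by
        simp only [Pi.sub_apply]; ring
      rw [e]
      simp only [Pi.add_apply, enorm_eq_self, hG]
      refine (enorm_add_le _ _).trans (add_le_add ((enorm_add_le _ _).trans (add_le_add ?_ ?_)) ?_)
      · exact enorm_sub_average_le hden hc hδ0 hδr (hi f) (htΩ hy) hxy
      · rw [enorm_neg]
        exact enorm_sub_average_le hden hc hδ0 hδr (hi g) (htΩ hy) hxy
      · rw [Real.enorm_eq_ofReal_abs]
        exact ENNReal.ofReal_le_ofReal (hclose y hy)
    have hR : ∀ h : Lp ℝ (ENNReal.ofReal p) (volume.restrict Ω),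
        eLpNorm (diffQuot s p h) (ENNReal.ofReal p)
          ((volume.restrict Ω).prod (volume.restrict Ω)) ≤ ENNReal.ofReal R' →
        eLpNorm (G h) (ENNReal.ofReal p) (volume.restrict Ω) ≤ ENNReal.ofReal (C * δ ^ s * R') := by
      intro h hh
      rw [hG]
      refine (hosc δ hδ0 h (hm h)).trans ?_
      rw [ENNReal.ofReal_mul (p := C * δ ^ s) (by positivity)]
      gcongr
    have hconst : eLpNorm (fun _ : EuclideanSpace ℝ (Fin n) => ENNReal.ofReal η)
        (ENNReal.ofReal p) (volume.restrict Ω) < ENNReal.ofReal (ε / 3) := by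
      rw [eLpNorm_const' _ (by simp; linarith) (by simp), ENNReal.toReal_ofReal hp0.le,
        enorm_eq_self]
      rw [← ENNReal.ofReal_toReal (ENNReal.rpow_ne_top_of_nonneg (by positivity : 0 ≤ 1 / p)
        (measure_ne_top (volume.restrict Ω) Set.univ)), ← ENNReal.ofReal_mul hη0.le]
      exact (ENNReal.ofReal_lt_ofReal_iff (by positivity)).2 hη
    have hlt : ENNReal.ofReal (C * δ ^ s * R') < ENNReal.ofReal (ε / 3) :=
      (ENNReal.ofReal_lt_ofReal_iff (by positivity)).2 hδε
    have hfinal : edist f g < ENNReal.ofReal ε := by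
      rw [Lp.edist_def]
      calc eLpNorm (f - g : EuclideanSpace ℝ (Fin n) → ℝ) (ENNReal.ofReal p) (volume.restrict Ω)
          ≤ eLpNorm (G f + G g + fun _ => ENNReal.ofReal η) (ENNReal.ofReal p)
              (volume.restrict Ω) := eLpNorm_mono_enorm_ae hpt
        _ ≤ eLpNorm (G f) (ENNReal.ofReal p) (volume.restrict Ω) +
            eLpNorm (G g) (ENNReal.ofReal p) (volume.restrict Ω) +
            eLpNorm (fun _ : EuclideanSpace ℝ (Fin n) => ENNReal.ofReal η) (ENNReal.ofReal p)
              (volume.restrict Ω) :=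
            (eLpNorm_add_le ((hGm f).add (hGm g)) aestronglyMeasurable_const hP1).trans
              (add_le_add_left (eLpNorm_add_le (hGm f) (hGm g) hP1) _)
        _ < ENNReal.ofReal (ε / 3) + ENNReal.ofReal (ε / 3) + ENNReal.ofReal (ε / 3) :=
            ENNReal.add_lt_add (ENNReal.add_lt_add ((hR f hf.2).trans_lt hlt)
              ((hR g hg.2).trans_lt hlt)) hconst
        _ = ENNReal.ofReal ε := by
            rw [← ENNReal.ofReal_add (by positivity) (by positivity),
              ← ENNReal.ofReal_add (by positivity) (by positivity)]
            congr 1; ring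
    rw [edist_dist] at hfinal
    exact (ENNReal.ofReal_lt_ofReal_iff hε).1 hfinal

/-- Rellich's theorem for a regular set: a sequence bounded in `W^{s,p}(Ω)` has a subsequence
which converges in `L^p(Ω)` and almost everywhere. -/
lemma exists_subseq_tendsto (hs0 : 0 < s) (hp : 1 < p) [IsFiniteMeasure (volume.restrict Ω)]
    (hΩ : MeasurableSet Ω) (hb : Bornology.IsBounded Ω)
    {c r₀ : ℝ} (hc : 0 < c) (hr₀ : 0 < r₀) (hden : MeasureDensity Ω c r₀) {R R' : ℝ}
    {us : ℕ → EuclideanSpace ℝ (Fin n) → ℝ}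
    (hus : ∀ k, MemLp (us k) (ENNReal.ofReal p) (volume.restrict Ω))
    (h1 : ∀ k, eLpNorm (us k) (ENNReal.ofReal p) (volume.restrict Ω) ≤ ENNReal.ofReal R)
    (h2 : ∀ k, eLpNorm (diffQuot s p (us k)) (ENNReal.ofReal p)
        ((volume.restrict Ω).prod (volume.restrict Ω)) ≤ ENNReal.ofReal R') :
    ∃ (u : EuclideanSpace ℝ (Fin n) → ℝ) (ns : ℕ → ℕ), StrictMono ns ∧
      MemLp u (ENNReal.ofReal p) (volume.restrict Ω) ∧
      Tendsto (fun k => eLpNorm (us (ns k) - u) (ENNReal.ofReal p) (volume.restrict Ω))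
        atTop (𝓝 0) ∧
      ∀ᵐ x ∂(volume.restrict Ω), Tendsto (fun k => us (ns k) x) atTop (𝓝 (u x)) := by
  have : Fact (1 ≤ ENNReal.ofReal p) := ⟨by simpa using hp.le⟩
  have htb := totallyBounded_of_measureDensity (R := max R 0) (R' := R') hs0 hp hΩ hb hc hr₀ hden
  have hcomp := htb.closure.isCompact_of_isClosed isClosed_closure
  have hmem : ∀ k, (hus k).toLp ∈ closure
      {f : Lp ℝ (ENNReal.ofReal p) (volume.restrict Ω) | ‖f‖ ≤ max R 0 ∧
      eLpNorm (diffQuot s p f) (ENNReal.ofReal p)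
        ((volume.restrict Ω).prod (volume.restrict Ω)) ≤ ENNReal.ofReal R'} := by
    refine fun k => subset_closure ⟨?_, ?_⟩
    · rw [Lp.norm_toLp, ← ENNReal.toReal_ofReal_eq_iff.2 (le_max_right R 0)]
      refine ENNReal.toReal_mono (by simp) ((h1 k).trans ?_)
      exact ENNReal.ofReal_le_ofReal (le_max_left _ _)
    · rw [eLpNorm_congr_ae (diffQuot_ae_congr (hus k).coeFn_toLp)]
      exact h2 k
  obtain ⟨u, -, ns, hns, hlim⟩ := hcomp.tendsto_subseq hmem
  have hlim' : Tendsto (fun k => eLpNorm (us (ns k) - (u : EuclideanSpace ℝ (Fin n) → ℝ))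
      (ENNReal.ofReal p) (volume.restrict Ω)) atTop (𝓝 0) := by
    rw [tendsto_iff_edist_tendsto_0] at hlim
    refine hlim.congr fun k => ?_
    rw [Lp.edist_def]
    exact eLpNorm_congr_ae ((hus _).coeFn_toLp.sub (ae_eq_refl _))
  obtain ⟨ms, hms, hae⟩ := (tendstoInMeasure_of_tendsto_eLpNorm (by simp; linarith)
    (fun k => (hus (ns k)).1) (Lp.aestronglyMeasurable u) hlim').exists_seq_tendsto_ae
  exact ⟨u, ns ∘ ms, hns.comp hms, Lp.memLp u, hlim'.comp hms.tendsto_atTop, hae⟩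

end Compactness

section Mollifier

variable {n : ℕ} {Ω : Set (EuclideanSpace ℝ (Fin n))} {s p : ℝ}

/-! ### Mollification normalized on `Ω` -/

/-- A smooth bump function on `ℝⁿ`, equal to `1` on the ball of radius `δ` and supported in the
ball of radius `2δ`. -/
def scaledBump (n : ℕ) (δ : ℝ) (x : EuclideanSpace ℝ (Fin n)) : ℝ :=
  (⟨1, 2, one_pos, one_lt_two⟩ : ContDiffBump (0 : EuclideanSpace ℝ (Fin n))) (δ⁻¹ • x)

lemma scaledBump_nonneg (δ : ℝ) (x : EuclideanSpace ℝ (Fin n)) : 0 ≤ scaledBump n δ x :=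
  ContDiffBump.nonneg _

lemma scaledBump_le_one (δ : ℝ) (x : EuclideanSpace ℝ (Fin n)) : scaledBump n δ x ≤ 1 :=
  ContDiffBump.le_one _

lemma scaledBump_eq_one {δ : ℝ} (hδ : 0 < δ) {x : EuclideanSpace ℝ (Fin n)} (hx : ‖x‖ ≤ δ) :
    scaledBump n δ x = 1 := by
  refine ContDiffBump.one_of_mem_closedBall _ ?_
  rw [mem_closedBall_zero_iff, norm_smul, norm_inv, Real.norm_of_nonneg hδ.le]
  exact (inv_mul_le_one₀ hδ).2 hx

lemma scaledBump_eq_zero {δ : ℝ} (hδ : 0 < δ) {x : EuclideanSpace ℝ (Fin n)} (hx : 2 * δ ≤ ‖x‖) :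
    scaledBump n δ x = 0 := by
  refine ContDiffBump.zero_of_le_dist _ ?_
  rw [dist_zero_right, norm_smul, norm_inv, Real.norm_of_nonneg hδ.le]
  change (2 : ℝ) ≤ _
  rwa [inv_mul_eq_div, le_div_iff₀ hδ]

lemma contDiff_scaledBump (δ : ℝ) : ContDiff ℝ 1 (scaledBump n δ) :=
  (ContDiffBump.contDiff _).comp (contDiff_const_smul _)

lemma hasCompactSupport_scaledBump {δ : ℝ} (hδ : 0 < δ) : HasCompactSupport (scaledBump n δ) := by
  refine HasCompactSupport.intro (isCompact_closedBall 0 (2 * δ)) fun x hx => ?_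
  rw [mem_closedBall_zero_iff, not_le] at hx
  exact scaledBump_eq_zero hδ hx.le

lemma exists_lipschitz_scaledBump (n : ℕ) : ∃ L : ℝ, 0 ≤ L ∧ ∀ δ > 0,
    ∀ x y : EuclideanSpace ℝ (Fin n), |scaledBump n δ x - scaledBump n δ y| ≤ L * (‖x - y‖ / δ) := by
  obtain ⟨L, hL⟩ := ContDiff.lipschitzWith_of_hasCompactSupport (𝕂 := ℝ) (n := 1)
    (ContDiffBump.hasCompactSupport
      (⟨1, 2, one_pos, one_lt_two⟩ : ContDiffBump (0 : EuclideanSpace ℝ (Fin n))))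
    (ContDiffBump.contDiff _) one_ne_zero
  refine ⟨L, L.2, fun δ hδ x y => ?_⟩
  have := hL.dist_le_mul (δ⁻¹ • x) (δ⁻¹ • y)
  rw [Real.dist_eq, dist_eq_norm, ← smul_sub, norm_smul, norm_inv, Real.norm_of_nonneg hδ.le,
    inv_mul_eq_div] at this
  exact this

/-- Convolution of `f 1_Ω` with the scaled bump function. -/
def mollify (Ω : Set (EuclideanSpace ℝ (Fin n))) (δ : ℝ) (f : EuclideanSpace ℝ (Fin n) → ℝ)
    (x : EuclideanSpace ℝ (Fin n)) : ℝ :=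
  ∫ z in Ω, scaledBump n δ (x - z) * f z

lemma contDiff_mollify (hΩ : MeasurableSet Ω) {δ : ℝ} (hδ : 0 < δ)
    {f : EuclideanSpace ℝ (Fin n) → ℝ} (hf : IntegrableOn f Ω) :
    ContDiff ℝ 1 (mollify Ω δ f) := by
  have h := (hasCompactSupport_scaledBump (n := n) hδ).contDiff_convolution_right
    (n := 1) (ContinuousLinearMap.mul ℝ ℝ) (μ := volume)
    (hf.integrable_indicator hΩ).locallyIntegrable (contDiff_scaledBump δ)
  have e : mollify Ω δ f = convolution (Ω.indicator f) (scaledBump n δ)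
      (ContinuousLinearMap.mul ℝ ℝ) volume := by
    ext x
    rw [mollify, convolution_def, ← integral_indicator hΩ]
    refine integral_congr_ae (Eventually.of_forall fun z => ?_)
    by_cases hz : z ∈ Ω <;> simp [hz, mul_comm]
  rw [e]
  exact mod_cast h

lemma integrable_scaledBump_mul {δ : ℝ} {f : EuclideanSpace ℝ (Fin n) → ℝ}
    (hf : IntegrableOn f Ω) (x : EuclideanSpace ℝ (Fin n)) :
    Integrable (fun z => scaledBump n δ (x - z) * f z) (volume.restrict Ω) := by
  refine hf.bdd_mul (c := 1) ?_ (Eventually.of_forall fun z => ?_)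
  · exact ((contDiff_scaledBump δ).continuous.comp (by fun_prop)).aestronglyMeasurable
  · rw [Real.norm_of_nonneg (scaledBump_nonneg _ _)]
    exact scaledBump_le_one _ _

/-- A smooth positive function of `t ≥ 0` which equals `t` for `t ≥ m`. -/
def regularize (m t : ℝ) : ℝ :=
  t * Real.smoothTransition (t / m) + m * (1 - Real.smoothTransition (t / m))

lemma regularize_pos {m t : ℝ} (hm : 0 < m) (ht : 0 ≤ t) : 0 < regularize m t := by
  rcases ht.eq_or_lt with rfl | ht
  · simpa [regularize] using hm
  · have h0 := Real.smoothTransition.nonneg (t / m)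
    have h1 := Real.smoothTransition.le_one (t / m)
    rw [regularize]
    rcases h0.eq_or_lt with h | h
    · rw [← h]; simpa using hm
    · exact add_pos_of_pos_of_nonneg (by positivity) (mul_nonneg hm.le (by linarith))

lemma regularize_eq {m t : ℝ} (hm : 0 < m) (ht : m ≤ t) : regularize m t = t := by
  have : Real.smoothTransition (t / m) = 1 :=
    Real.smoothTransition.one_of_one_le ((one_le_div hm).2 ht)
  simp [regularize, this]

lemma contDiff_regularize (m : ℝ) : ContDiff ℝ 1 (regularize m) := by
  have h : ContDiff ℝ 1 fun t : ℝ => Real.smoothTransition (t / m) :=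
    Real.smoothTransition.contDiff.comp (contDiff_id.div_const m)
  exact (contDiff_id.mul h).add (contDiff_const.mul (contDiff_const.sub h))

/-- Mollification of `u` on `Ω`, normalized to preserve constants on `Ω` if `m` is a lower bound
for the mollification of `1`. -/
def smoothing (Ω : Set (EuclideanSpace ℝ (Fin n))) (m δ : ℝ) (u : EuclideanSpace ℝ (Fin n) → ℝ)
    (x : EuclideanSpace ℝ (Fin n)) : ℝ :=
  mollify Ω δ u x / regularize m (mollify Ω δ (fun _ => 1) x)

lemma mollify_one_nonneg (δ : ℝ) (x : EuclideanSpace ℝ (Fin n)) :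
    0 ≤ mollify Ω δ (fun _ => 1) x :=
  integral_nonneg fun _ => mul_nonneg (scaledBump_nonneg _ _) zero_le_one

/-- The oscillation `osc` as a real number. -/
def oscReal (Ω : Set (EuclideanSpace ℝ (Fin n))) (δ : ℝ) (u : EuclideanSpace ℝ (Fin n) → ℝ)
    (x : EuclideanSpace ℝ (Fin n)) : ℝ :=
  ∫ z in Ω, (Metric.ball x (3 * δ)).indicator (fun z => |u z - u x|) z

lemma oscReal_nonneg (δ : ℝ) (u : EuclideanSpace ℝ (Fin n) → ℝ) (x : EuclideanSpace ℝ (Fin n)) :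
    0 ≤ oscReal Ω δ u x :=
  integral_nonneg fun z => Set.indicator_nonneg (fun _ _ => abs_nonneg _) z

variable [IsFiniteMeasure (volume.restrict Ω)]

/-- Test functions must be `C¹` on the whole space, whereas the mollification of `1` vanishes far
from `Ω`; the regularized denominator is positive everywhere. -/
lemma contDiff_smoothing (hΩ : MeasurableSet Ω) {m δ : ℝ} (hm : 0 < m) (hδ : 0 < δ)
    {u : EuclideanSpace ℝ (Fin n) → ℝ} (hu : IntegrableOn u Ω) :
    ContDiff ℝ 1 (smoothing Ω m δ u) :=
  (contDiff_mollify hΩ hδ hu).div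
    ((contDiff_regularize m).comp (contDiff_mollify hΩ hδ (integrable_const 1)))
    fun x => (regularize_pos hm (mollify_one_nonneg δ x)).ne'

lemma le_mollify_one {c r₀ δ : ℝ} (hden : MeasureDensity Ω c r₀) (hδ : 0 < δ) (hδr : δ ≤ r₀)
    {x : EuclideanSpace ℝ (Fin n)} (hx : x ∈ Ω) : c * δ ^ n ≤ mollify Ω δ (fun _ => 1) x := by
  have hA : volume (Ω ∩ Metric.ball x δ) ≠ ⊤ :=
    ((measure_mono Set.inter_subset_right).trans_lt measure_ball_lt_top).ne
  have h1 : c * δ ^ n ≤ (volume (Ω ∩ Metric.ball x δ)).toReal :=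
    (ENNReal.ofReal_le_iff_le_toReal hA).1 (hden x hx δ hδ hδr)
  refine h1.trans ?_
  have h2 : (volume (Ω ∩ Metric.ball x δ)).toReal =
      ∫ z in Ω, (Metric.ball x δ).indicator (fun _ => (1 : ℝ)) z := by
    rw [integral_indicator Metric.isOpen_ball.measurableSet,
      Measure.restrict_restrict Metric.isOpen_ball.measurableSet, Set.inter_comm]
    simp [Measure.real]
  rw [h2]
  refine integral_mono ((integrable_const 1).indicator Metric.isOpen_ball.measurableSet)
    (integrable_scaledBump_mul (integrable_const 1) x) fun z => ?_
  by_cases hz : z ∈ Metric.ball x δ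
  · simp only [hz, Set.indicator_of_mem, mul_one]
    rw [scaledBump_eq_one hδ]
    rw [← dist_eq_norm, dist_comm]
    exact (Metric.mem_ball.1 hz).le
  · simp only [hz, not_false_eq_true, Set.indicator_of_notMem, mul_one]
    exact scaledBump_nonneg _ _

lemma mollify_sub_const {δ : ℝ} {u : EuclideanSpace ℝ (Fin n) → ℝ} (hu : IntegrableOn u Ω) (a : ℝ)
    (x : EuclideanSpace ℝ (Fin n)) :
    mollify Ω δ (fun z => u z - a) x = mollify Ω δ u x - a * mollify Ω δ (fun _ => 1) x := by
  rw [mollify, mollify, mollify, ← integral_const_mul,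
    ← integral_sub (integrable_scaledBump_mul hu x)
      ((integrable_scaledBump_mul (integrable_const 1) x).const_mul a)]
  congr 1
  ext z
  ring

/-- On `Ω` density keeps the mollification of `1` above the threshold, so the regularization is
inactive and constants are preserved. Taking `a = u x` turns errors into oscillations. -/
lemma smoothing_sub {c r₀ δ : ℝ} (hden : MeasureDensity Ω c r₀) (hc : 0 < c) (hδ : 0 < δ)
    (hδr : δ ≤ r₀) {u : EuclideanSpace ℝ (Fin n) → ℝ} (hu : IntegrableOn u Ω)
    {x : EuclideanSpace ℝ (Fin n)} (hx : x ∈ Ω) (a : ℝ) :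
    smoothing Ω (c * δ ^ n) δ u x - a =
      mollify Ω δ (fun z => u z - a) x / mollify Ω δ (fun _ => 1) x := by
  have hm : 0 < c * δ ^ n := by positivity
  have h := le_mollify_one hden hδ hδr hx
  rw [smoothing, regularize_eq hm h, mollify_sub_const hu]
  have : 0 < mollify Ω δ (fun _ => 1) x := hm.trans_le h
  field_simp

lemma integrable_indicator_abs_sub (δ : ℝ) {u : EuclideanSpace ℝ (Fin n) → ℝ}
    (hu : IntegrableOn u Ω) (x : EuclideanSpace ℝ (Fin n)) :
    Integrable ((Metric.ball x (3 * δ)).indicator (fun z => |u z - u x|))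
      (volume.restrict Ω) :=
  (Integrable.sub hu (integrable_const (u x))).abs.indicator Metric.isOpen_ball.measurableSet

lemma ofReal_oscReal (δ : ℝ) {u : EuclideanSpace ℝ (Fin n) → ℝ} (hu : IntegrableOn u Ω)
    (x : EuclideanSpace ℝ (Fin n)) : ENNReal.ofReal (oscReal Ω δ u x) = osc Ω δ u x := by
  rw [oscReal, ofReal_integral_eq_lintegral_ofReal (integrable_indicator_abs_sub δ hu x)
    (Eventually.of_forall fun z => Set.indicator_nonneg (fun _ _ => abs_nonneg _) z), osc]
  refine lintegral_congr fun z => ?_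
  by_cases hz : z ∈ Metric.ball x (3 * δ) <;> simp [hz, Real.enorm_eq_ofReal_abs]

lemma abs_integral_mul_le_oscReal {δ b : ℝ} {u k : EuclideanSpace ℝ (Fin n) → ℝ}
    (hu : IntegrableOn u Ω) (x : EuclideanSpace ℝ (Fin n)) (hk : ∀ z, |k z| ≤ b)
    (hk0 : ∀ z, 3 * δ ≤ ‖x - z‖ → k z = 0) :
    |∫ z in Ω, k z * (u z - u x)| ≤ b * oscReal Ω δ u x := by
  rw [oscReal, ← integral_const_mul, ← Real.norm_eq_abs]
  refine norm_integral_le_of_norm_le ((integrable_indicator_abs_sub δ hu x).const_mul b)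
    (Eventually.of_forall fun z => ?_)
  rw [Real.norm_eq_abs, abs_mul]
  by_cases hz : z ∈ Metric.ball x (3 * δ)
  · rw [Set.indicator_of_mem hz]
    exact mul_le_mul_of_nonneg_right (hk z) (abs_nonneg _)
  · rw [Set.indicator_of_notMem hz, hk0 z]
    · simp
    · rw [← dist_eq_norm, dist_comm]
      simpa using hz

lemma abs_smoothing_sub_le {c r₀ δ : ℝ} (hden : MeasureDensity Ω c r₀) (hc : 0 < c) (hδ : 0 < δ)
    (hδr : δ ≤ r₀) {u : EuclideanSpace ℝ (Fin n) → ℝ} (hu : IntegrableOn u Ω)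
    {x : EuclideanSpace ℝ (Fin n)} (hx : x ∈ Ω) :
    |smoothing Ω (c * δ ^ n) δ u x - u x| ≤ oscReal Ω δ u x / (c * δ ^ n) := by
  have hm : 0 < c * δ ^ n := by positivity
  have hρ := le_mollify_one hden hδ hδr hx
  rw [smoothing_sub hden hc hδ hδr hu hx, abs_div, abs_of_pos (hm.trans_le hρ)]
  refine div_le_div₀ (oscReal_nonneg _ _ _) ?_ hm hρ
  have := abs_integral_mul_le_oscReal (Ω := Ω) (δ := δ) (b := 1)
    (k := fun z => scaledBump n δ (x - z)) hu x
    (fun z => by rw [abs_of_nonneg (scaledBump_nonneg _ _)]; exact scaledBump_le_one _ _)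
    (fun z hz => scaledBump_eq_zero hδ (by linarith))
  rwa [one_mul] at this

/-- If `|x - y| ≥ δ`, compare both values with `u`. Otherwise subtract `u x` and use that the bump
is Lipschitz with constant `L / δ`. The factor `min 1 (|x-y| / δ)` makes the kernel integrable
across the diagonal. -/
lemma exists_abs_smoothing_sub_smoothing_le {c : ℝ} (hc : 0 < c) : ∃ K : ℝ, 1 ≤ K ∧
    ∀ r₀ δ : ℝ, MeasureDensity Ω c r₀ → 0 < δ → δ ≤ r₀ →
    ∀ u : EuclideanSpace ℝ (Fin n) → ℝ, IntegrableOn u Ω → ∀ x ∈ Ω, ∀ y ∈ Ω,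
    |smoothing Ω (c * δ ^ n) δ u x - smoothing Ω (c * δ ^ n) δ u y| ≤
      K * min 1 (‖x - y‖ / δ) * (oscReal Ω δ u x / (c * δ ^ n) + oscReal Ω δ u y / (c * δ ^ n)) +
        |u x - u y| := by
  obtain ⟨L, hL0, hL⟩ := exists_lipschitz_scaledBump n
  have hω := unitBallVolume_pos n
  -- Chosen so that the ball of radius `3δ` has volume `B c δ^n`.
  set B : ℝ := 3 ^ n * unitBallVolume n / c with hB
  have hB0 : 0 ≤ B := by positivity
  refine ⟨1 + L * (1 + B), le_add_of_nonneg_right (by positivity),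
    fun r₀ δ hden hδ hδr u hu x hx y hy => ?_⟩
  have hm : 0 < c * δ ^ n := by positivity
  set m := c * δ ^ n with hmdef
  have hgx : 0 ≤ oscReal Ω δ u x / m := div_nonneg (oscReal_nonneg _ _ _) hm.le
  have hgy : 0 ≤ oscReal Ω δ u y / m := div_nonneg (oscReal_nonneg _ _ _) hm.le
  rcases le_or_gt δ ‖x - y‖ with hfar | hnear
  · rw [min_eq_left ((one_le_div hδ).2 hfar), mul_one]
    have h1 := abs_smoothing_sub_le hden hc hδ hδr hu hx
    have h2 := abs_smoothing_sub_le hden hc hδ hδr hu hy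
    rw [abs_sub_comm] at h2
    have h3 : 0 ≤ L * (1 + B) * (oscReal Ω δ u x / m + oscReal Ω δ u y / m) := by positivity
    calc |smoothing Ω m δ u x - smoothing Ω m δ u y|
        = |(smoothing Ω m δ u x - u x) + (u x - u y) + (u y - smoothing Ω m δ u y)| := by
          congr 1; ring
      _ ≤ |smoothing Ω m δ u x - u x| + |u x - u y| + |u y - smoothing Ω m δ u y| :=
          abs_add_three _ _ _
      _ ≤ _ := by linarith
  · rw [min_eq_right ((div_le_one hδ).2 hnear.le)]
    set M := ‖x - y‖ / δ with hM
    have hM0 : 0 ≤ M := by positivity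
    set I := oscReal Ω δ u x with hI
    have hI0 : 0 ≤ I := oscReal_nonneg _ _ _
    set ρ := mollify Ω δ (fun _ => 1) with hρdef
    have hρx : m ≤ ρ x := le_mollify_one hden hδ hδr hx
    have hρy : m ≤ ρ y := le_mollify_one hden hδ hδr hy
    have hρx0 := hm.trans_le hρx
    have hρy0 := hm.trans_le hρy
    set w : EuclideanSpace ℝ (Fin n) → ℝ := fun z => u z - u x with hw
    have hwi : IntegrableOn w Ω := Integrable.sub hu (integrable_const (u x))
    have hk : ∀ z, |scaledBump n δ (x - z) - scaledBump n δ (y - z)| ≤ L * M := fun z => by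
      have := hL δ hδ (x - z) (y - z)
      rwa [sub_sub_sub_cancel_right] at this
    -- This is why the oscillation uses radius `3δ`: the bump around `y` has radius `2δ`, and `y` is
    -- within `δ` of `x`.
    have hyz : ∀ z, 3 * δ ≤ ‖x - z‖ → 2 * δ ≤ ‖y - z‖ := fun z hz => by
      have := norm_sub_le_norm_sub_add_norm_sub x y z
      linarith
    have hk0 : ∀ z, 3 * δ ≤ ‖x - z‖ →
        scaledBump n δ (x - z) - scaledBump n δ (y - z) = 0 := fun z hz => by
      rw [scaledBump_eq_zero hδ (by linarith), scaledBump_eq_zero hδ (hyz z hz), sub_zero]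
    have hN : |mollify Ω δ w x - mollify Ω δ w y| ≤ L * M * I := by
      rw [mollify, mollify, ← integral_sub (integrable_scaledBump_mul hwi x)
        (integrable_scaledBump_mul hwi y)]
      simp_rw [← sub_mul]
      exact abs_integral_mul_le_oscReal hu x hk hk0
    have hNy : |mollify Ω δ w y| ≤ I := by
      have := abs_integral_mul_le_oscReal (Ω := Ω) (δ := δ) (b := 1)
        (k := fun z => scaledBump n δ (y - z)) hu x
        (fun z => by rw [abs_of_nonneg (scaledBump_nonneg _ _)]; exact scaledBump_le_one _ _)
        (fun z hz => scaledBump_eq_zero hδ (hyz z hz))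
      rwa [one_mul] at this
    have hρ : |ρ x - ρ y| ≤ L * M * (B * m) := by
      rw [hρdef, mollify, mollify, ← integral_sub
        (integrable_scaledBump_mul (integrable_const 1) x)
        (integrable_scaledBump_mul (integrable_const 1) y)]
      simp_rw [← sub_mul, mul_one]
      have hv : ∫ z in Ω, (Metric.ball x (3 * δ)).indicator (fun _ => (1 : ℝ)) z ≤ B * m := by
        rw [integral_indicator Metric.isOpen_ball.measurableSet,
          Measure.restrict_restrict Metric.isOpen_ball.measurableSet]
        simp only [integral_const, smul_eq_mul, mul_one, Measure.real, Measure.restrict_apply_univ]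
        refine (ENNReal.toReal_mono measure_ball_lt_top.ne
          (measure_mono Set.inter_subset_left)).trans (le_of_eq ?_)
        rw [volume_ball_eq x (by positivity), ENNReal.toReal_ofReal (by positivity), hB, hmdef,
          mul_pow]
        field_simp
      refine le_trans ?_ (mul_le_mul_of_nonneg_left hv (by positivity))
      rw [← integral_const_mul, ← Real.norm_eq_abs]
      refine norm_integral_le_of_norm_le
        (((integrable_const 1).indicator Metric.isOpen_ball.measurableSet).const_mul _)
        (Eventually.of_forall fun z => ?_)
      by_cases hz : z ∈ Metric.ball x (3 * δ)
      · rw [Set.indicator_of_mem hz, mul_one]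
        exact hk z
      · rw [Set.indicator_of_notMem hz, hk0 z]
        · simp
        · rw [← dist_eq_norm, dist_comm]
          simpa using hz
    have hsplit : smoothing Ω m δ u x - smoothing Ω m δ u y =
        (mollify Ω δ w x - mollify Ω δ w y) / ρ x +
          mollify Ω δ w y * (ρ y - ρ x) / (ρ x * ρ y) := by
      have e1 : smoothing Ω m δ u x - u x = mollify Ω δ w x / ρ x :=
        smoothing_sub hden hc hδ hδr hu hx (u x)
      have e2 : smoothing Ω m δ u y - u x = mollify Ω δ w y / ρ y :=
        smoothing_sub hden hc hδ hδr hu hy (u x)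
      have : smoothing Ω m δ u x - smoothing Ω m δ u y =
        (smoothing Ω m δ u x - u x) - (smoothing Ω m δ u y - u x) := by ring
      rw [this, e1, e2]
      field_simp
      ring
    have b1 : |(mollify Ω δ w x - mollify Ω δ w y) / ρ x| ≤ L * M * I / m := by
      rw [abs_div, abs_of_pos hρx0]
      exact div_le_div₀ (by positivity) hN hm hρx
    have b2 : |mollify Ω δ w y * (ρ y - ρ x) / (ρ x * ρ y)| ≤
        I * (L * M * (B * m)) / (m * m) := by
      rw [abs_div, abs_mul, abs_of_pos (mul_pos hρx0 hρy0)]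
      rw [abs_sub_comm] at hρ
      refine div_le_div₀ (by positivity) ?_ (by positivity) ?_
      · exact mul_le_mul hNy hρ (abs_nonneg _) hI0
      · exact mul_le_mul hρx hρy hm.le hρx0.le
    have e3 : L * M * I / m + I * (L * M * (B * m)) / (m * m) = L * (1 + B) * M * (I / m) := by
      field_simp
    rw [hsplit]
    refine (abs_add_le _ _).trans ((add_le_add b1 b2).trans ?_)
    rw [e3]
    have h5 : L * (1 + B) * M * (I / m) ≤ (1 + L * (1 + B)) * M * (I / m) := by gcongr; linarith
    have h6 : 0 ≤ (1 + L * (1 + B)) * M * (oscReal Ω δ u y / m) := by positivity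
    have h7 := abs_nonneg (u x - u y)
    rw [mul_add]
    linarith

end Mollifier

section Density

variable {n : ℕ} {Ω : Set (EuclideanSpace ℝ (Fin n))} {s p : ℝ}

/-! ### Density of smooth functions -/

/-- The Gagliardo kernel, truncated near the diagonal at scale `δ`. -/
def truncKernel (s p δ : ℝ) (z : EuclideanSpace ℝ (Fin n) × EuclideanSpace ℝ (Fin n)) : ENNReal :=
  ENNReal.ofReal (min 1 (‖z.1 - z.2‖ / δ) / ‖z.1 - z.2‖ ^ ((n : ℝ) / p + s))

lemma measurable_truncKernel (s p δ : ℝ) : Measurable (truncKernel (n := n) s p δ) := by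
  unfold truncKernel
  fun_prop

lemma truncKernel_swap (δ : ℝ) (z : EuclideanSpace ℝ (Fin n) × EuclideanSpace ℝ (Fin n)) :
    truncKernel s p δ z.swap = truncKernel s p δ z := by
  simp only [truncKernel, Prod.fst_swap, Prod.snd_swap, norm_sub_rev]

/-- Tonelli: the weight depends on the first variable only, and the integral of the kernel in the
second is bounded by that over the whole space. -/
lemma exists_lintegral_truncKernel_mul_le (Ω : Set (EuclideanSpace ℝ (Fin n))) (hn : 1 ≤ n)
    (hs0 : 0 < s) (hs1 : s < 1) (hp : 1 < p) :
    ∃ C : ℝ, 0 ≤ C ∧ ∀ δ > 0, ∀ G : EuclideanSpace ℝ (Fin n) → ENNReal, Measurable G →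
      ∫⁻ z, (truncKernel s p δ z * G z.1) ^ p ∂((volume.restrict Ω).prod (volume.restrict Ω)) ≤
        ENNReal.ofReal (C * δ ^ (-(s * p))) * ∫⁻ x in Ω, G x ^ p := by
  have hp0 : 0 < p := by linarith
  obtain ⟨C, hC, h⟩ := exists_lintegral_kernel_le (n := n) hn hs0 hs1 hp
  refine ⟨C, hC, fun δ hδ G hG => ?_⟩
  have hm : Measurable fun z : EuclideanSpace ℝ (Fin n) × EuclideanSpace ℝ (Fin n) =>
      truncKernel s p δ z * G z.1 := (measurable_truncKernel s p δ).mul (hG.comp measurable_fst)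
  rw [lintegral_prod _ (hm.pow_const p).aemeasurable, ← lintegral_const_mul' _ _ (by finiteness)]
  refine lintegral_mono fun x => ?_
  simp_rw [ENNReal.mul_rpow_of_nonneg _ _ hp0.le]
  rw [lintegral_mul_const]
  · gcongr
    exact (lintegral_mono' Measure.restrict_le_self le_rfl).trans (h δ hδ x)
  · exact ((measurable_truncKernel s p δ).comp measurable_prodMk_left).pow_const p

lemma exists_eLpNorm_truncKernel_mul_le (Ω : Set (EuclideanSpace ℝ (Fin n))) (hn : 1 ≤ n)
    (hs0 : 0 < s) (hs1 : s < 1) (hp : 1 < p) :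
    ∃ C : ℝ, 0 ≤ C ∧ ∀ δ > 0, ∀ G : EuclideanSpace ℝ (Fin n) → ENNReal, Measurable G →
      eLpNorm (fun z => truncKernel s p δ z * G z.1) (ENNReal.ofReal p)
          ((volume.restrict Ω).prod (volume.restrict Ω)) ≤
        ENNReal.ofReal (C * δ ^ (-s)) * eLpNorm G (ENNReal.ofReal p) (volume.restrict Ω) := by
  have hp0 : 0 < p := by linarith
  obtain ⟨C, hC, h⟩ := exists_lintegral_truncKernel_mul_le Ω hn hs0 hs1 hp
  refine ⟨C ^ (1 / p), by positivity, fun δ hδ G hG => ?_⟩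
  rw [eLpNorm_eq_lintegral_rpow_enorm_toReal (by simp; linarith) (by simp),
    eLpNorm_eq_lintegral_rpow_enorm_toReal (by simp; linarith) (by simp),
    ENNReal.toReal_ofReal hp0.le]
  simp only [enorm_eq_self]
  refine (ENNReal.rpow_le_rpow (h δ hδ G hG) (by positivity)).trans (le_of_eq ?_)
  rw [ENNReal.mul_rpow_of_nonneg _ _ (by positivity),
    ENNReal.ofReal_rpow_of_nonneg (by positivity) (by positivity),
    Real.mul_rpow hC (by positivity), ← Real.rpow_mul hδ.le]
  congr 4
  field_simp

lemma eLpNorm_truncKernel_mul_snd (δ : ℝ) {G : EuclideanSpace ℝ (Fin n) → ENNReal}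
    (hG : Measurable G) :
    eLpNorm (fun z => truncKernel s p δ z * G z.2) (ENNReal.ofReal p)
        ((volume.restrict Ω).prod (volume.restrict Ω)) =
      eLpNorm (fun z => truncKernel s p δ z * G z.1) (ENNReal.ofReal p)
        ((volume.restrict Ω).prod (volume.restrict Ω)) := by
  have hm : Measurable fun z : EuclideanSpace ℝ (Fin n) × EuclideanSpace ℝ (Fin n) =>
      truncKernel s p δ z * G z.1 := (measurable_truncKernel s p δ).mul (hG.comp measurable_fst)
  have h := eLpNorm_comp_measurePreserving (p := ENNReal.ofReal p)
    (μ := (volume.restrict Ω).prod (volume.restrict Ω))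
    (ν := (volume.restrict Ω).prod (volume.restrict Ω)) hm.aestronglyMeasurable
    Measure.measurePreserving_swap
  rw [← h]
  congr 1
  ext z
  simp only [Function.comp, truncKernel_swap, Prod.fst_swap]

lemma memW_of_contDiff (hn : 1 ≤ n) (hs0 : 0 < s) (hs1 : s < 1) (hp : 1 < p)
    [IsFiniteMeasure (volume.restrict Ω)] (hΩ : MeasurableSet Ω) (hb : Bornology.IsBounded Ω)
    {φ : EuclideanSpace ℝ (Fin n) → ℝ} (hφ : ContDiff ℝ 1 φ) : MemW Ω s p φ := by
  obtain ⟨R, hR⟩ := hb.subset_closedBall 0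
  set B : Set (EuclideanSpace ℝ (Fin n)) := Metric.closedBall 0 (max R 1) with hB
  have hΩB : Ω ⊆ B := hR.trans (Metric.closedBall_subset_closedBall (le_max_left _ _))
  have hR0 : 0 < max R 1 := zero_lt_one.trans_le (le_max_right _ _)
  obtain ⟨K, hK⟩ := hφ.contDiffOn.exists_lipschitzOnWith one_ne_zero
    (convex_closedBall _ _) (isCompact_closedBall (0 : EuclideanSpace ℝ (Fin n)) (max R 1))
  obtain ⟨M, hM⟩ := (isCompact_closedBall (0 : EuclideanSpace ℝ (Fin n))
    (max R 1)).exists_bound_of_continuousOn hφ.continuous.continuousOn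
  obtain ⟨C, hC, hker⟩ := exists_eLpNorm_truncKernel_mul_le Ω hn hs0 hs1 hp
  rw [memW_iff]
  refine ⟨MemLp.of_bound hφ.continuous.aestronglyMeasurable M
    ((ae_restrict_mem hΩ).mono fun x hx => hM x (hΩB hx)), ?_⟩
  refine ⟨aestronglyMeasurable_diffQuot hφ.continuous.aestronglyMeasurable, ?_⟩
  -- At the scale of the diameter of the ball the minimum in the kernel is always `|x - y| / ρ`, so
  -- the Lipschitz bound is exactly of truncated-kernel form.
  set ρ : ℝ := 2 * max R 1 with hρ
  have hρ0 : 0 < ρ := by positivity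
  have hae : ∀ᵐ z ∂((volume.restrict Ω).prod (volume.restrict Ω)),
      ‖diffQuot s p φ z‖ₑ ≤ ‖truncKernel s p ρ z * ENNReal.ofReal (K * ρ)‖ₑ := by
    filter_upwards [Measure.quasiMeasurePreserving_fst.ae (ae_restrict_mem hΩ),
      Measure.quasiMeasurePreserving_snd.ae (ae_restrict_mem hΩ)] with z h1 h2
    have hz1 := hΩB h1
    have hz2 := hΩB h2
    have hd : ‖z.1 - z.2‖ ≤ ρ := by
      rw [hB, mem_closedBall_zero_iff] at hz1 hz2
      linarith [norm_sub_le z.1 z.2]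
    rw [enorm_eq_self, truncKernel, ← ENNReal.ofReal_mul (by positivity), Real.enorm_eq_ofReal_abs]
    refine ENNReal.ofReal_le_ofReal ?_
    have hlip := hK.dist_le_mul _ hz1 _ hz2
    rw [Real.dist_eq, dist_eq_norm] at hlip
    rw [diffQuot, abs_div, abs_of_nonneg (Real.rpow_nonneg (norm_nonneg _) _),
      min_eq_right ((div_le_one hρ0).2 hd), div_mul_eq_mul_div]
    gcongr
    refine hlip.trans (le_of_eq ?_)
    field_simp
  refine (eLpNorm_mono_enorm_ae hae).trans_lt ?_
  refine (hker ρ hρ0 (fun _ => ENNReal.ofReal (K * ρ)) measurable_const).trans_lt ?_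
  refine ENNReal.mul_lt_top (by simp) ?_
  rw [eLpNorm_const' _ (by simp; linarith) (by simp), ENNReal.toReal_ofReal (by linarith)]
  refine ENNReal.mul_lt_top ENNReal.ofReal_lt_top (ENNReal.rpow_lt_top_of_nonneg ?_ (measure_ne_top _ _))
  exact one_div_nonneg.2 (by linarith)

/-- Uniformity in `δ` is the point: the normalized oscillation gains `δ^s`, the truncated kernel
loses `δ^(-s)`, and the two cancel. -/
lemma exists_eLpNorm_diffQuot_smoothing_le (hn : 1 ≤ n) (hs0 : 0 < s) (hs1 : s < 1) (hp : 1 < p)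
    [IsFiniteMeasure (volume.restrict Ω)] (hΩ : MeasurableSet Ω) {c : ℝ} (hc : 0 < c) :
    ∃ C : ℝ, ∀ r₀ δ : ℝ, MeasureDensity Ω c r₀ → 0 < δ → δ ≤ r₀ →
      ∀ u : EuclideanSpace ℝ (Fin n) → ℝ, Measurable u → IntegrableOn u Ω →
      eLpNorm (diffQuot s p (smoothing Ω (c * δ ^ n) δ u)) (ENNReal.ofReal p)
          ((volume.restrict Ω).prod (volume.restrict Ω)) ≤
        ENNReal.ofReal C * eLpNorm (diffQuot s p u) (ENNReal.ofReal p)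
          ((volume.restrict Ω).prod (volume.restrict Ω)) := by
  have hP1 : (1 : ENNReal) ≤ ENNReal.ofReal p := by simpa using hp.le
  obtain ⟨C₁, hC₁, hosc⟩ := eLpNorm_osc_le (Ω := Ω) (n := n) hp hs0 hc
  obtain ⟨C₂, hC₂, hker⟩ := exists_eLpNorm_truncKernel_mul_le Ω hn hs0 hs1 hp
  obtain ⟨K, hK1, hpt⟩ := exists_abs_smoothing_sub_smoothing_le (Ω := Ω) (n := n) hc
  have hK0 : 0 ≤ K := by linarith
  refine ⟨K * C₁ * C₂ + K * C₁ * C₂ + 1, fun r₀ δ hden hδ hδr u hum hu => ?_⟩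
  have hm : 0 < c * δ ^ n := by positivity
  set m := c * δ ^ n with hmdef
  set ν := (volume.restrict Ω).prod (volume.restrict Ω) with hν
  set N := eLpNorm (diffQuot s p u) (ENNReal.ofReal p) ν with hN
  obtain ⟨G, hG⟩ : ∃ G : EuclideanSpace ℝ (Fin n) → ENNReal,
      G = fun x => ENNReal.ofReal K * (osc Ω δ u x / ENNReal.ofReal m) := ⟨_, rfl⟩
  have hoscm : Measurable fun x => osc Ω δ u x / ENNReal.ofReal m :=
    (measurable_osc δ hum).div_const _
  have hGm : Measurable G := by rw [hG]; exact hoscm.const_mul _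
  have hGreal : ∀ x, G x = ENNReal.ofReal (K * (oscReal Ω δ u x / m)) := fun x => by
    rw [hG, ENNReal.ofReal_mul hK0, ENNReal.ofReal_div_of_pos hm, ofReal_oscReal δ hu]
  have hGnorm : eLpNorm G (ENNReal.ofReal p) (volume.restrict Ω) ≤
      ENNReal.ofReal (K * C₁ * δ ^ s) * N := by
    have h1 : eLpNorm G (ENNReal.ofReal p) (volume.restrict Ω) ≤ ENNReal.ofReal K *
        eLpNorm (fun x => osc Ω δ u x / ENNReal.ofReal m) (ENNReal.ofReal p)
          (volume.restrict Ω) := by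
      have hp0 : 0 < p := by linarith
      rw [eLpNorm_eq_lintegral_rpow_enorm_toReal (by simp; linarith) (by simp),
        eLpNorm_eq_lintegral_rpow_enorm_toReal (by simp; linarith) (by simp),
        ENNReal.toReal_ofReal hp0.le, hG]
      simp only [enorm_eq_self]
      simp_rw [ENNReal.mul_rpow_of_nonneg (ENNReal.ofReal K) _ hp0.le]
      rw [lintegral_const_mul' _ _ (by finiteness), ENNReal.mul_rpow_of_nonneg _ _ (by positivity),
        ← ENNReal.rpow_mul, mul_one_div_cancel hp0.ne', ENNReal.rpow_one]
    refine h1.trans ((mul_le_mul_right (hosc δ hδ u hum) _).trans (le_of_eq ?_))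
    rw [← mul_assoc, ← ENNReal.ofReal_mul hK0, mul_assoc]
  have hF1 : eLpNorm (fun z => truncKernel s p δ z * G z.1) (ENNReal.ofReal p) ν ≤
      ENNReal.ofReal (K * C₁ * C₂) * N := by
    refine (hker δ hδ G hGm).trans ((mul_le_mul_right hGnorm _).trans (le_of_eq ?_))
    rw [← mul_assoc, ← ENNReal.ofReal_mul (by positivity)]
    congr 2
    rw [Real.rpow_neg hδ.le]
    field_simp
  have hF2 : eLpNorm (fun z => truncKernel s p δ z * G z.2) (ENNReal.ofReal p) ν ≤
      ENNReal.ofReal (K * C₁ * C₂) * N := by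
    rw [hν, eLpNorm_truncKernel_mul_snd δ hGm]
    exact hF1
  have hm1 : AEStronglyMeasurable (fun z => truncKernel s p δ z * G z.1) ν :=
    ((measurable_truncKernel s p δ).mul (hGm.comp measurable_fst)).aestronglyMeasurable
  have hm2 : AEStronglyMeasurable (fun z => truncKernel s p δ z * G z.2) ν :=
    ((measurable_truncKernel s p δ).mul (hGm.comp measurable_snd)).aestronglyMeasurable
  have hm3 : AEStronglyMeasurable (fun z => ‖diffQuot s p u z‖ₑ) ν :=
    (measurable_diffQuot hum).enorm.aestronglyMeasurable
  have hae : ∀ᵐ z ∂ν, ‖diffQuot s p (smoothing Ω m δ u) z‖ₑ ≤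
      ‖((fun z => truncKernel s p δ z * G z.1) + (fun z => truncKernel s p δ z * G z.2) +
        (fun z => ‖diffQuot s p u z‖ₑ) :
        EuclideanSpace ℝ (Fin n) × EuclideanSpace ℝ (Fin n) → ENNReal) z‖ₑ := by
    filter_upwards [Measure.quasiMeasurePreserving_fst.ae (ae_restrict_mem hΩ),
      Measure.quasiMeasurePreserving_snd.ae (ae_restrict_mem hΩ)] with z h1 h2
    have hgx : 0 ≤ oscReal Ω δ u z.1 / m := div_nonneg (oscReal_nonneg _ _ _) hm.le
    have hgy : 0 ≤ oscReal Ω δ u z.2 / m := div_nonneg (oscReal_nonneg _ _ _) hm.le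
    simp only [Pi.add_apply, enorm_eq_self]
    rw [hGreal, hGreal, truncKernel, ← ENNReal.ofReal_mul (by positivity),
      ← ENNReal.ofReal_mul (by positivity), Real.enorm_eq_ofReal_abs, Real.enorm_eq_ofReal_abs,
      ← ENNReal.ofReal_add (by positivity) (by positivity),
      ← ENNReal.ofReal_add (by positivity) (by positivity)]
    refine ENNReal.ofReal_le_ofReal ?_
    have hkk : 0 ≤ ‖z.1 - z.2‖ ^ ((n : ℝ) / p + s) := by positivity
    rw [diffQuot, diffQuot, abs_div, abs_div, abs_of_nonneg hkk, div_mul_eq_mul_div,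
      div_mul_eq_mul_div, ← add_div, ← add_div]
    gcongr
    refine (hpt r₀ δ hden hδ hδr u hu z.1 h1 z.2 h2).trans (le_of_eq ?_)
    ring
  calc eLpNorm (diffQuot s p (smoothing Ω m δ u)) (ENNReal.ofReal p) ν
      ≤ _ := eLpNorm_mono_enorm_ae hae
    _ ≤ eLpNorm (fun z => truncKernel s p δ z * G z.1) (ENNReal.ofReal p) ν +
        eLpNorm (fun z => truncKernel s p δ z * G z.2) (ENNReal.ofReal p) ν +
        eLpNorm (fun z => ‖diffQuot s p u z‖ₑ) (ENNReal.ofReal p) ν :=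
        (eLpNorm_add_le (hm1.add hm2) hm3 hP1).trans
          (add_le_add_left (eLpNorm_add_le hm1 hm2 hP1) _)
    _ ≤ ENNReal.ofReal (K * C₁ * C₂) * N + ENNReal.ofReal (K * C₁ * C₂) * N + N := by
        refine add_le_add (add_le_add hF1 hF2) (le_of_eq ?_)
        rw [hN, eLpNorm_enorm]
    _ = _ := by
        rw [ENNReal.ofReal_add (by positivity) (by positivity),
          ENNReal.ofReal_add (by positivity) (by positivity), ENNReal.ofReal_one, add_mul, add_mul,
          one_mul]

/-- Every `u ∈ W^{s,p}(Ω)` is the a.e. limit of a sequence of `C¹` functions which is bounded in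
`W^{s,p}(Ω)`. -/
lemma exists_contDiff_approx (hn : 1 ≤ n) (hs0 : 0 < s) (hs1 : s < 1) (hp : 1 < p)
    [IsFiniteMeasure (volume.restrict Ω)] (hΩ : MeasurableSet Ω)
    {c r₀ : ℝ} (hc : 0 < c) (hr₀ : 0 < r₀) (hden : MeasureDensity Ω c r₀)
    {u : EuclideanSpace ℝ (Fin n) → ℝ} (hu : MemW Ω s p u) :
    ∃ (φ : ℕ → EuclideanSpace ℝ (Fin n) → ℝ) (B : ENNReal), B ≠ ⊤ ∧ (∀ k, ContDiff ℝ 1 (φ k)) ∧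
      (∀ k, eLpNorm (φ k - u) (ENNReal.ofReal p) (volume.restrict Ω) ≤ B) ∧
      (∀ k, eLpNorm (diffQuot s p (φ k) - diffQuot s p u) (ENNReal.ofReal p)
        ((volume.restrict Ω).prod (volume.restrict Ω)) ≤ B) ∧
      ∀ᵐ x ∂(volume.restrict Ω), Tendsto (fun k => φ k x) atTop (𝓝 (u x)) := by
  have hP1 : (1 : ENNReal) ≤ ENNReal.ofReal p := by simpa using hp.le
  wlog hum : Measurable u generalizing u
  · set v := hu.1.1.mk u with hv
    have huv : u =ᵐ[volume.restrict Ω] v := hu.1.1.ae_eq_mk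
    have hD := diffQuot_ae_congr (s := s) (p := p) huv
    have hvW : MemW Ω s p v := by
      rw [memW_iff] at *
      exact ⟨hu.1.ae_eq huv, hu.2.ae_eq hD⟩
    obtain ⟨φ, B, hB, h1, h2, h3, h4⟩ := this hvW hu.1.1.stronglyMeasurable_mk.measurable
    refine ⟨φ, B, hB, h1, fun k => ?_, fun k => ?_, ?_⟩
    · rw [eLpNorm_congr_ae ((ae_eq_refl _).sub huv)]
      exact h2 k
    · rw [eLpNorm_congr_ae ((ae_eq_refl _).sub hD)]
      exact h3 k
    · filter_upwards [h4, huv] with x hx hx'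
      rwa [hx']
  have hui : IntegrableOn u Ω := hu.1.integrable hP1
  obtain ⟨C₁, hC₁, hosc⟩ := eLpNorm_osc_le (Ω := Ω) (n := n) hp hs0 hc
  obtain ⟨C, hC⟩ := exists_eLpNorm_diffQuot_smoothing_le (Ω := Ω) hn hs0 hs1 hp hΩ hc
  set ν := (volume.restrict Ω).prod (volume.restrict Ω) with hν
  set N := eLpNorm (diffQuot s p u) (ENNReal.ofReal p) ν with hN
  have hNtop : N ≠ ⊤ := (memW_iff.1 hu).2.2.ne
  set δ : ℕ → ℝ := fun k => r₀ / (k + 1) with hδ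
  have hδ0 : ∀ k, 0 < δ k := fun k => by positivity
  have hδr : ∀ k, δ k ≤ r₀ := fun k => div_le_self hr₀.le (by linarith [k.cast_nonneg (α := ℝ)])
  obtain ⟨φ, hφ⟩ : ∃ φ : ℕ → EuclideanSpace ℝ (Fin n) → ℝ,
    ∀ k, φ k = smoothing Ω (c * δ k ^ n) (δ k) u := ⟨_, fun _ => rfl⟩
  have hφc : ∀ k, ContDiff ℝ 1 (φ k) := fun k => by
    rw [hφ]
    exact contDiff_smoothing hΩ (mul_pos hc (pow_pos (hδ0 k) n)) (hδ0 k) hui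
  have hφu : ∀ k, eLpNorm (φ k - u) (ENNReal.ofReal p) (volume.restrict Ω) ≤
      ENNReal.ofReal (C₁ * δ k ^ s) * N := fun k => by
    refine le_trans (eLpNorm_mono_enorm_ae ?_) (hosc (δ k) (hδ0 k) u hum)
    filter_upwards [ae_restrict_mem hΩ] with x hx
    have := abs_smoothing_sub_le hden hc (hδ0 k) (hδr k) hui hx
    rw [enorm_eq_self, Pi.sub_apply, hφ, Real.enorm_eq_ofReal_abs, ← ofReal_oscReal _ hui,
      ← ENNReal.ofReal_div_of_pos (mul_pos hc (pow_pos (hδ0 k) n))]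
    exact ENNReal.ofReal_le_ofReal this
  have hlim : Tendsto (fun k => eLpNorm (φ k - u) (ENNReal.ofReal p) (volume.restrict Ω))
      atTop (𝓝 0) := by
    have h1 : Tendsto (fun k => C₁ * δ k ^ s) atTop (𝓝 0) := by
      have h2 : Tendsto δ atTop (𝓝 0) := by
        have := (tendsto_one_div_add_atTop_nhds_zero_nat (𝕜 := ℝ)).const_mul r₀
        simpa only [hδ, mul_one_div, mul_zero] using this
      have h3 := (h2.rpow_const (Or.inr hs0.le : (0 : ℝ) ≠ 0 ∨ 0 ≤ s)).const_mul C₁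
      simpa [Real.zero_rpow hs0.ne'] using h3
    have h4 := ENNReal.Tendsto.mul_const (ENNReal.tendsto_ofReal h1)
      (Or.inr hNtop : ENNReal.ofReal 0 ≠ 0 ∨ N ≠ ⊤)
    rw [ENNReal.ofReal_zero, zero_mul] at h4
    exact tendsto_of_tendsto_of_tendsto_of_le_of_le tendsto_const_nhds h4 (fun _ => zero_le) hφu
  obtain ⟨ns, hns, hae⟩ := (tendstoInMeasure_of_tendsto_eLpNorm (by simp; linarith)
    (fun k => (hφc k).continuous.aestronglyMeasurable) hu.1.1 hlim).exists_seq_tendsto_ae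
  refine ⟨fun k => φ (ns k), ENNReal.ofReal (C₁ * r₀ ^ s) * N + (ENNReal.ofReal C * N + N),
    by finiteness, fun k => hφc _, fun k => ?_, fun k => ?_, hae⟩
  · refine (hφu _).trans (le_add_right ?_)
    have := hδr (ns k)
    have := (hδ0 (ns k)).le
    gcongr
  · refine le_add_left ?_
    refine (eLpNorm_sub_le (aestronglyMeasurable_diffQuot
      (hφc _).continuous.aestronglyMeasurable) (memW_iff.1 hu).2.1 hP1).trans ?_
    gcongr
    rw [hφ]
    exact hC r₀ _ hden (hδ0 _) (hδr _) u hum hui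

end Density

section Eigenvalue

variable {n : ℕ} {Ω : Set (EuclideanSpace ℝ (Fin n))} {s p : ℝ}

/-! ### The first eigenvalue -/

lemma eLpNorm_eq_ofReal {X : Type*} [MeasurableSpace X] {ν : Measure X} (hp : 1 < p) {f : X → ℝ}
    (hf : MemLp f (ENNReal.ofReal p) ν) :
    eLpNorm f (ENNReal.ofReal p) ν = ENNReal.ofReal ((∫ x, |f x| ^ p ∂ν) ^ (1 / p)) := by
  rw [← eLpNorm_toReal_rpow hp hf.1, ← Real.rpow_mul ENNReal.toReal_nonneg,
    mul_one_div_cancel (by linarith), Real.rpow_one, ENNReal.ofReal_toReal hf.2.ne]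

lemma tendsto_integral_abs_rpow {X : Type*} [MeasurableSpace X] {ν : Measure X} (hp : 1 < p)
    {fs : ℕ → X → ℝ} {f : X → ℝ} (hfs : ∀ k, MemLp (fs k) (ENNReal.ofReal p) ν)
    (hf : MemLp f (ENNReal.ofReal p) ν)
    (h : Tendsto (fun k => eLpNorm (fs k - f) (ENNReal.ofReal p) ν) atTop (𝓝 0)) :
    Tendsto (fun k => ∫ x, |fs k x| ^ p ∂ν) atTop (𝓝 (∫ x, |f x| ^ p ∂ν)) := by
  have : Fact (1 ≤ ENNReal.ofReal p) := ⟨by simpa using hp.le⟩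
  have h1 := ((Lp.tendsto_Lp_iff_tendsto_eLpNorm'' fs hfs f hf).2 h).norm
  simp only [Lp.norm_toLp] at h1
  have h2 := h1.rpow_const (p := p) (Or.inr (by linarith))
  rw [eLpNorm_toReal_rpow hp hf.1] at h2
  exact h2.congr fun k => eLpNorm_toReal_rpow hp (hfs k).1

lemma ae_eq_zero_of_integral_abs_rpow {X : Type*} [MeasurableSpace X] {ν : Measure X} (hp : 1 < p)
    {f : X → ℝ} (hf : MemLp f (ENNReal.ofReal p) ν) (h : ∫ x, |f x| ^ p ∂ν = 0) :
    f =ᵐ[ν] 0 := by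
  rw [integral_eq_zero_iff_of_nonneg (fun x => by positivity) (integrable_abs_rpow hp hf)] at h
  filter_upwards [h] with x hx
  have := (Real.rpow_eq_zero (abs_nonneg (f x)) (by linarith)).1 hx
  simpa using this

lemma integral_abs_rpow_pos {X : Type*} [MeasurableSpace X] {ν : Measure X} (hp : 1 < p)
    {f : X → ℝ} (hf : MemLp f (ENNReal.ofReal p) ν) (h : ¬ f =ᵐ[ν] 0) :
    0 < ∫ x, |f x| ^ p ∂ν :=
  lt_of_le_of_ne (integral_nonneg fun x => by positivity) fun h0 =>
    h (ae_eq_zero_of_integral_abs_rpow hp hf h0.symm)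

lemma quotient_nonneg (hp : 1 < p) {u : EuclideanSpace ℝ (Fin n) → ℝ} (hu : MemW Ω s p u) :
    0 ≤ quotient Ω s p u := by
  rw [quotient_eq hp hu]
  exact div_nonneg (integral_nonneg fun z => by positivity) (integral_nonneg fun x => by positivity)

lemma lambda1_le (hp : 1 < p) {u : EuclideanSpace ℝ (Fin n) → ℝ} (hu : u ∈ admissible Ω s p) :
    lambda1 Ω s p ≤ quotient Ω s p u := by
  refine csInf_le ⟨0, ?_⟩ (Set.mem_image_of_mem _ hu)
  rintro _ ⟨v, hv, rfl⟩
  exact quotient_nonneg hp hv.1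

lemma lambda1_nonneg (hp : 1 < p) : 0 ≤ lambda1 Ω s p := by
  refine Real.sInf_nonneg ?_
  rintro _ ⟨v, hv, rfl⟩
  exact quotient_nonneg hp hv.1

lemma ae_eq_const_of_diffQuot (hp : 1 < p) (hμ : volume.restrict Ω ≠ 0)
    {v : EuclideanSpace ℝ (Fin n) → ℝ} (hv : MemW Ω s p v)
    (h : ∫ z, |diffQuot s p v z| ^ p ∂((volume.restrict Ω).prod (volume.restrict Ω)) = 0) :
    ∃ c : ℝ, v =ᵐ[volume.restrict Ω] fun _ => c := by
  have h1 := ae_eq_zero_of_integral_abs_rpow hp (memW_iff.1 hv).2 h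
  have h2 := Measure.ae_ae_of_ae_prod h1
  have : (ae (volume.restrict Ω)).NeBot := ae_neBot.2 hμ
  obtain ⟨x, hx⟩ := h2.exists
  refine ⟨v x, hx.mono fun y hy => ?_⟩
  simp only [diffQuot, Pi.zero_apply] at hy
  rcases eq_or_ne x y with rfl | hxy
  · rfl
  · have hk : 0 < ‖x - y‖ := norm_pos_iff.2 (sub_ne_zero.2 hxy)
    rcases div_eq_zero_iff.1 hy with h | h
    · linarith
    · exact absurd h (by positivity)

lemma exists_normalized (hp : 1 < p) {v : EuclideanSpace ℝ (Fin n) → ℝ}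
    (hv : v ∈ admissible Ω s p) : ∃ w : EuclideanSpace ℝ (Fin n) → ℝ, MemW Ω s p w ∧
      ∫ x in Ω, |w x| ^ p = 1 ∧ ∫ x in Ω, signedPow p (w x) = 0 ∧
      ∫ z, |diffQuot s p w z| ^ p ∂((volume.restrict Ω).prod (volume.restrict Ω)) =
        quotient Ω s p v := by
  have hp0 : 0 < p := by linarith
  obtain ⟨hW, h0, hJ⟩ := hv
  have hpos := integral_abs_rpow_pos hp hW.1 h0
  set N := ∫ x in Ω, |v x| ^ p with hN
  set t : ℝ := N ^ (-(1 / p)) with ht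
  have ht0 : 0 < t := by positivity
  have htp : t ^ p = N⁻¹ := by
    rw [ht, ← Real.rpow_mul hpos.le, neg_mul, one_div_mul_cancel hp0.ne', Real.rpow_neg_one]
  have hD : ∀ z, diffQuot s p (fun x => t * v x) z = t * diffQuot s p v z := fun z => by
    simp only [diffQuot]; ring
  refine ⟨fun x => t * v x, ?_, ?_, ?_, ?_⟩
  · rw [memW_iff] at *
    rw [funext hD]
    exact ⟨hW.1.const_mul t, hW.2.const_mul t⟩
  · simp_rw [abs_mul, abs_of_pos ht0, Real.mul_rpow ht0.le (abs_nonneg _)]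
    rw [integral_const_mul, htp, ← hN, inv_mul_cancel₀ hpos.ne']
  · simp_rw [signedPow_mul ht0]
    rw [integral_const_mul]
    exact mul_eq_zero_of_right _ hJ
  · simp_rw [hD, abs_mul, abs_of_pos ht0, Real.mul_rpow ht0.le (abs_nonneg _)]
    rw [integral_const_mul, htp, quotient_eq hp hW, ← hN, div_eq_inv_mul]

variable [IsFiniteMeasure (volume.restrict Ω)]

/-- The Poincaré inequality with the optimal constant `λ₁`. -/
lemma lambda1_mul_le (hp : 1 < p) {v : EuclideanSpace ℝ (Fin n) → ℝ} (hv : MemW Ω s p v) {c : ℝ}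
    (hc : ∫ x in Ω, signedPow p (v x - c) = 0) :
    lambda1 Ω s p * ∫ x in Ω, |v x - c| ^ p ≤
      ∫ z, |diffQuot s p v z| ^ p ∂((volume.restrict Ω).prod (volume.restrict Ω)) := by
  have hw : MemW Ω s p fun x => v x - c := hv.sub_const c
  by_cases h0 : (fun x => v x - c) =ᵐ[volume.restrict Ω] 0
  · have : ∫ x in Ω, |v x - c| ^ p = 0 := by
      rw [← integral_zero (EuclideanSpace ℝ (Fin n)) ℝ (μ := volume.restrict Ω)]
      refine integral_congr_ae ?_
      filter_upwards [h0] with x hx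
      simp only [Pi.zero_apply] at hx
      rw [hx, abs_zero, Real.zero_rpow (by linarith)]
    rw [this, mul_zero]
    exact integral_nonneg fun z => by positivity
  · have h1 := lambda1_le hp (u := fun x => v x - c) ⟨hw, h0, hc⟩
    rwa [quotient_eq hp hw, diffQuot_sub_const, le_div_iff₀ (integral_abs_rpow_pos hp hw.1 h0)] at h1

/-! ### Existence and positivity of the minimum -/

lemma admissible_nonempty (hn : 1 ≤ n) (hs0 : 0 < s) (hs1 : s < 1) (hp : 1 < p) (hΩ : IsOpen Ω)
    (hb : Bornology.IsBounded Ω) (hne : Ω.Nonempty) : (admissible Ω s p).Nonempty := by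
  let i : Fin n := ⟨0, hn⟩
  have hcd : ContDiff ℝ 1 fun x : EuclideanSpace ℝ (Fin n) => x i := by fun_prop
  have hW : MemW Ω s p fun x : EuclideanSpace ℝ (Fin n) => x i :=
    memW_of_contDiff hn hs0 hs1 hp hΩ.measurableSet hb hcd
  obtain ⟨c, hc⟩ := exists_integral_signedPow_sub_eq_zero hp hW.1
  refine ⟨fun x => x i - c, hW.sub_const c, fun h0 => ?_, hc⟩
  have heq : Set.EqOn (fun x : EuclideanSpace ℝ (Fin n) => x i - c) (fun _ => 0) Ω :=
    Measure.eqOn_open_of_ae_eq h0 hΩ (hcd.continuous.sub continuous_const).continuousOn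
      continuousOn_const
  obtain ⟨x, hx⟩ := hne
  obtain ⟨ε, hε, hball⟩ := Metric.isOpen_iff.1 hΩ x hx
  have hy : x + EuclideanSpace.single i (ε / 2) ∈ Ω := hball <| by
    rw [Metric.mem_ball, dist_eq_norm, add_sub_cancel_left, PiLp.norm_single,
      Real.norm_of_nonneg (by positivity)]
    linarith
  have h1 := heq hx
  have h2 := heq hy
  simp only [PiLp.add_apply, PiLp.single_apply, if_true] at h1 h2
  linarith

lemma exists_minimizer (hn : 1 ≤ n) (hs0 : 0 < s) (hs1 : s < 1) (hp : 1 < p) (hΩ : IsOpen Ω)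
    (hb : Bornology.IsBounded Ω) (hne : Ω.Nonempty)
    {c r₀ : ℝ} (hc : 0 < c) (hr₀ : 0 < r₀) (hden : MeasureDensity Ω c r₀) :
    ∃ u ∈ admissible Ω s p, quotient Ω s p u = lambda1 Ω s p := by
  have hp0 : 0 < p := by linarith
  have hbdd : BddBelow (quotient Ω s p '' admissible Ω s p) := by
    refine ⟨0, ?_⟩
    rintro _ ⟨v, hv, rfl⟩
    exact quotient_nonneg hp hv.1
  obtain ⟨q, hqanti, hqlim, hqmem⟩ := exists_seq_tendsto_sInf
    ((admissible_nonempty hn hs0 hs1 hp hΩ hb hne).image (quotient Ω s p)) hbdd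
  have hw : ∀ k, ∃ w : EuclideanSpace ℝ (Fin n) → ℝ, MemW Ω s p w ∧
      ∫ x in Ω, |w x| ^ p = 1 ∧ ∫ x in Ω, signedPow p (w x) = 0 ∧
      ∫ z, |diffQuot s p w z| ^ p ∂((volume.restrict Ω).prod (volume.restrict Ω)) = q k := by
    intro k
    obtain ⟨v, hv, hvq⟩ := hqmem k
    rw [← hvq]
    exact exists_normalized hp hv
  choose w hwW hw1 hwJ hwq using hw
  have hDnorm : ∀ k, eLpNorm (diffQuot s p (w k)) (ENNReal.ofReal p)
      ((volume.restrict Ω).prod (volume.restrict Ω)) = ENNReal.ofReal (q k ^ (1 / p)) := fun k => by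
    rw [eLpNorm_eq_ofReal hp (memW_iff.1 (hwW k)).2, hwq]
  have hq0 : ∀ k, 0 ≤ q k := fun k => by
    rw [← hwq]; exact integral_nonneg fun z => by positivity
  obtain ⟨u, ns, hns, huLp, hlim, hae⟩ := exists_subseq_tendsto (R := 1) (R' := q 0 ^ (1 / p))
    hs0 hp hΩ.measurableSet hb hc hr₀ hden (fun k => (hwW k).1)
    (fun k => by rw [eLpNorm_eq_ofReal hp (hwW k).1, hw1, Real.one_rpow])
    (fun k => by
      rw [hDnorm]
      exact ENNReal.ofReal_le_ofReal
        (Real.rpow_le_rpow (hq0 k) (hqanti (Nat.zero_le k)) (by positivity)))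
  have hshift : ∀ a : ℝ, Tendsto (fun k => ∫ x in Ω, |w (ns k) x - a| ^ p) atTop
      (𝓝 (∫ x in Ω, |u x - a| ^ p)) := by
    intro a
    refine tendsto_integral_abs_rpow hp (fs := fun k x => w (ns k) x - a) (f := fun x => u x - a)
      (fun k => (hwW (ns k)).1.sub (memLp_const a)) (huLp.sub (memLp_const a)) (hlim.congr fun k => ?_)
    congr 1
    ext x
    simp
  have hu1 : ∫ x in Ω, |u x| ^ p = 1 := by
    have h := hshift 0
    simp only [sub_zero, hw1] at h
    exact tendsto_nhds_unique h tendsto_const_nhds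
  have hfatou : eLpNorm (diffQuot s p u) (ENNReal.ofReal p)
      ((volume.restrict Ω).prod (volume.restrict Ω)) ≤
        ENNReal.ofReal (lambda1 Ω s p ^ (1 / p)) := by
    refine (Lp.eLpNorm_lim_le_liminf_eLpNorm
      (fun k => (memW_iff.1 (hwW (ns k))).2.1) _ (diffQuot_tendsto hae)).trans (le_of_eq ?_)
    simp_rw [hDnorm]
    refine Tendsto.liminf_eq (ENNReal.tendsto_ofReal ?_)
    exact (hqlim.comp hns.tendsto_atTop).rpow_const (Or.inr (by positivity))
  have huW : MemW Ω s p u := memW_iff.2 ⟨huLp, aestronglyMeasurable_diffQuot huLp.1,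
    hfatou.trans_lt ENNReal.ofReal_lt_top⟩
  have huD : ∫ z, |diffQuot s p u z| ^ p ∂((volume.restrict Ω).prod (volume.restrict Ω)) ≤
      lambda1 Ω s p := by
    have hl := lambda1_nonneg (Ω := Ω) (s := s) hp
    have h1 := ENNReal.toReal_mono ENNReal.ofReal_ne_top hfatou
    rw [ENNReal.toReal_ofReal (by positivity)] at h1
    have h2 := Real.rpow_le_rpow ENNReal.toReal_nonneg h1 hp0.le
    rwa [eLpNorm_toReal_rpow hp (memW_iff.1 huW).2.1, ← Real.rpow_mul hl,
      one_div_mul_cancel hp0.ne', Real.rpow_one] at h2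
  -- The constraint is carried to the limit as a minimality property: by convexity each `w (ns k)`
  -- is best approximated by the constant `0`, this inequality passes to the limit, and its
  -- first-order condition is the constraint for `u`.
  have hmin : ∀ a : ℝ, ∫ x in Ω, |u x| ^ p ≤ ∫ x in Ω, |u x - a| ^ p := by
    intro a
    rw [hu1]
    refine ge_of_tendsto (hshift a) (Eventually.of_forall fun k => ?_)
    have h := integral_tangent_le hp (hwW (ns k)).1 ((hwW (ns k)).sub_const a).1
    have h0 : ∫ x in Ω, signedPow p (w (ns k) x) * (w (ns k) x - a - w (ns k) x) = 0 := by
      have : ∀ x, signedPow p (w (ns k) x) * (w (ns k) x - a - w (ns k) x) =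
        -a * signedPow p (w (ns k) x) := fun x => by ring
      simp_rw [this]
      rw [integral_const_mul, hwJ, mul_zero]
    rw [h0, hw1] at h
    simpa using h
  have huJ : ∫ x in Ω, signedPow p (u x) * 1 = 0 := by
    refine integral_signedPow_mul_eq_of_le hp huLp (memLp_const 1) fun t => ?_
    have := hmin (-t)
    simpa using this
  have hadm : u ∈ admissible Ω s p := by
    refine ⟨huW, fun h0 => ?_, by simpa [signedPow] using huJ⟩
    have : ∫ x in Ω, |u x| ^ p = 0 := by
      rw [← integral_zero (EuclideanSpace ℝ (Fin n)) ℝ (μ := volume.restrict Ω)]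
      refine integral_congr_ae ?_
      filter_upwards [h0] with x hx
      rw [hx, Pi.zero_apply, abs_zero, Real.zero_rpow hp0.ne']
    linarith
  refine ⟨u, hadm, le_antisymm ?_ (lambda1_le hp hadm)⟩
  rw [quotient_eq hp huW, hu1, div_one]
  exact huD

lemma lambda1_pos (hp : 1 < p) (hμ : volume.restrict Ω ≠ 0)
    {u : EuclideanSpace ℝ (Fin n) → ℝ} (hu : u ∈ admissible Ω s p)
    (hq : quotient Ω s p u = lambda1 Ω s p) : 0 < lambda1 Ω s p := by
  refine lt_of_le_of_ne (lambda1_nonneg hp) fun h0 => ?_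
  obtain ⟨hW, hne, hJ⟩ := hu
  rw [← h0, quotient_eq hp hW, div_eq_zero_iff] at hq
  obtain ⟨c, hc⟩ := ae_eq_const_of_diffQuot hp hμ hW
    (hq.resolve_right (integral_abs_rpow_pos hp hW.1 hne).ne')
  have h1 : ∫ x in Ω, signedPow p (u x) = (volume.restrict Ω).real Set.univ * signedPow p c := by
    rw [integral_congr_ae (g := fun _ => signedPow p c) (hc.mono fun x hx => by rw [hx]),
      integral_const, smul_eq_mul]
  have h2 : signedPow p c = 0 := by
    rw [show ∫ x in Ω, signedPow p (u x) = 0 from hJ] at h1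
    refine (mul_eq_zero.1 h1.symm).resolve_left ?_
    exact ENNReal.toReal_ne_zero.2 ⟨by simpa using hμ, measure_ne_top _ _⟩
  have h3 : c = 0 := by
    have h4 := signedPow_mul_self hp c
    rw [h2, zero_mul] at h4
    have := (Real.rpow_eq_zero (abs_nonneg c) (by linarith)).1 h4.symm
    simpa using this
  exact hne (hc.trans (by rw [h3]; rfl))

/-- The shift `c` depends on `t`, but nothing about this dependence is needed: it cancels on the
left in the seminorm and on the right because `J(u)` has mean zero. -/
lemma form_eq_of_minimizer (hp : 1 < p) {u φ : EuclideanSpace ℝ (Fin n) → ℝ}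
    (hu : u ∈ admissible Ω s p) (hq : quotient Ω s p u = lambda1 Ω s p) (hφ : MemW Ω s p φ) :
    form Ω s p u φ = lambda1 Ω s p * ∫ x in Ω, |u x| ^ (p - 2) * u x * φ x := by
  obtain ⟨hW, hne, hJ⟩ := hu
  rw [form_eq_integral hp hW hφ]
  refine integral_signedPow_mul_eq_of_le hp (memW_iff.1 hW).2 (memW_iff.1 hφ).2 fun t => ?_
  have hv := hW.add_mul hφ t
  obtain ⟨c, hc⟩ := exists_integral_signedPow_sub_eq_zero hp hv.1
  have h1 := lambda1_mul_le hp hv hc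
  simp_rw [diffQuot_add_mul] at h1
  refine le_trans ?_ h1
  have hEu : ∫ z, |diffQuot s p u z| ^ p ∂((volume.restrict Ω).prod (volume.restrict Ω)) =
      lambda1 Ω s p * ∫ x in Ω, |u x| ^ p := by
    rw [← hq, quotient_eq hp hW, div_mul_cancel₀ _ (integral_abs_rpow_pos hp hW.1 hne).ne']
  have h2 := integral_tangent_le hp hW.1 (hv.sub_const c).1
  have h3 : ∫ x in Ω, signedPow p (u x) * (u x + t * φ x - c - u x) =
      t * ∫ x in Ω, |u x| ^ (p - 2) * u x * φ x := by
    have hJi : Integrable (fun x => signedPow p (u x)) (volume.restrict Ω) := by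
      simpa using integrable_signedPow_mul hp hW.1 (memLp_const (1 : ℝ))
    have : ∀ x, signedPow p (u x) * (u x + t * φ x - c - u x) =
        t * (signedPow p (u x) * φ x) - c * signedPow p (u x) := fun x => by ring
    simp_rw [this]
    rw [integral_sub ((integrable_signedPow_mul hp hW.1 hφ.1).const_mul t) (hJi.const_mul c),
      integral_const_mul, integral_const_mul, show ∫ x in Ω, signedPow p (u x) = 0 from hJ,
      mul_zero, sub_zero]
    rfl
  rw [h3] at h2
  rw [hEu]
  have h4 := mul_le_mul_of_nonneg_left h2 (lambda1_nonneg (Ω := Ω) (s := s) hp)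
  refine le_trans (le_of_eq ?_) h4
  ring

lemma lambda1_le_of_isEigenvalue (hn : 1 ≤ n) (hs0 : 0 < s) (hs1 : s < 1) (hp : 1 < p)
    (hΩ : MeasurableSet Ω) (hb : Bornology.IsBounded Ω)
    {c r₀ : ℝ} (hc : 0 < c) (hr₀ : 0 < r₀) (hden : MeasureDensity Ω c r₀) {μ : ℝ}
    (hμ : IsEigenvalue Ω s p μ) (hμ0 : μ ≠ 0) : lambda1 Ω s p ≤ μ := by
  have hp0 : 0 < p := by linarith
  obtain ⟨u, hW, hne, heq⟩ := hμ
  -- The form vanishes against constants, so a nonzero eigenvalue forces the constraint.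
  have hJ : ∫ x in Ω, |u x| ^ (p - 2) * u x = 0 := by
    have h := heq (fun _ => 1) contDiff_const
    have h0 : form Ω s p u (fun _ => 1) = 0 := by simp [form]
    rw [h0] at h
    simpa [hμ0] using h.symm
  obtain ⟨φ, B, hB, hφc, hφ1, hφ2, hφ3⟩ :=
    exists_contDiff_approx hn hs0 hs1 hp hΩ hc hr₀ hden hW
  have hφW : ∀ k, MemW Ω s p (φ k) := fun k => memW_of_contDiff hn hs0 hs1 hp hΩ hb (hφc k)
  have hbound : ∀ {X : Type} [MeasurableSpace X] {ν : Measure X} {f g : X → ℝ},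
      MemLp f (ENNReal.ofReal p) ν → MemLp g (ENNReal.ofReal p) ν →
      eLpNorm (f - g) (ENNReal.ofReal p) ν ≤ B → ∫ x, |f x - g x| ^ p ∂ν ≤ B.toReal ^ p := by
    intro X _ ν f g hf hg h
    have h1 := eLpNorm_toReal_rpow hp (hf.sub hg).1
    simp only [Pi.sub_apply] at h1
    rw [← h1]
    exact Real.rpow_le_rpow ENNReal.toReal_nonneg (ENNReal.toReal_mono hB h) hp0.le
  have hl1 := tendsto_integral_signedPow_mul hp (memW_iff.1 hW).2 (memW_iff.1 hW).2
    (fun k => (memW_iff.1 (hφW k)).2)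
    (fun k => hbound (memW_iff.1 (hφW k)).2 (memW_iff.1 hW).2 (hφ2 k)) (diffQuot_tendsto hφ3)
  have hl2 := (tendsto_integral_signedPow_mul hp hW.1 hW.1 (fun k => (hφW k).1)
    (fun k => hbound (hφW k).1 hW.1 (hφ1 k)) hφ3).const_mul μ
  have heq' : ∀ k, ∫ z, signedPow p (diffQuot s p u z) * diffQuot s p (φ k) z
      ∂((volume.restrict Ω).prod (volume.restrict Ω)) =
      μ * ∫ x in Ω, signedPow p (u x) * φ k x := fun k => by
    rw [← form_eq_integral hp hW (hφW k), heq _ (hφc k)]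
    rfl
  -- In the limit the equation is tested with `u` itself: `[u]^p = μ ‖u‖^p`.
  have h := tendsto_nhds_unique (hl1.congr heq') hl2
  simp_rw [signedPow_mul_self hp] at h
  have hle := lambda1_le hp (u := u) ⟨hW, hne, hJ⟩
  rwa [quotient_eq hp hW, h, mul_div_cancel_right₀ _ (integral_abs_rpow_pos hp hW.1 hne).ne'] at hle

end Eigenvalue

end FracNeumann

end

theorem theorem3p1 {n : ℕ} (hn : 1 ≤ n) (Ω : Set (EuclideanSpace ℝ (Fin n)))
    (hΩ : FracNeumann.IsC1OpenSet Ω) (hbdd : Bornology.IsBounded Ω) (hne : Ω.Nonempty)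
    (s p : ℝ) (hs0 : 0 < s) (hs1 : s < 1) (hp : 1 < p) :
    (∃ u ∈ FracNeumann.admissible Ω s p,
      FracNeumann.quotient Ω s p u = FracNeumann.lambda1 Ω s p) ∧
    0 < FracNeumann.lambda1 Ω s p ∧
    IsLeast {μ : ℝ | FracNeumann.IsEigenvalue Ω s p μ ∧ μ ≠ 0} (FracNeumann.lambda1 Ω s p) := by
  have hfin : IsFiniteMeasure (volume.restrict Ω) :=
    ⟨by simpa using hbdd.measure_lt_top⟩
  have hμ : volume.restrict Ω ≠ 0 := by
    rw [Ne, Measure.restrict_eq_zero]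
    exact (hΩ.isOpen.measure_pos volume hne).ne'
  have hm := hΩ.isOpen.measurableSet
  obtain ⟨c, hc, r₀, hr₀, hden⟩ := hΩ.measureDensity hbdd
  obtain ⟨u, hu, hq⟩ :=
    FracNeumann.exists_minimizer hn hs0 hs1 hp hΩ.isOpen hbdd hne hc hr₀ hden
  have hpos := FracNeumann.lambda1_pos hp hμ hu hq
  refine ⟨⟨u, hu, hq⟩, hpos, ⟨⟨u, hu.1, hu.2.1, fun φ hφ => ?_⟩, hpos.ne'⟩, fun μ hμ' => ?_⟩
  · exact FracNeumann.form_eq_of_minimizer hp hu hq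
      (FracNeumann.memW_of_contDiff hn hs0 hs1 hp hm hbdd hφ)
  · exact FracNeumann.lambda1_le_of_isEigenvalue hn hs0 hs1 hp hm hbdd hc hr₀ hden hμ'.1 hμ'.2
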